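/- Let $(\lambda_n)_{n\ge 1}$ be real numbers with $\frac14\le\lambda_n\le\lambda<\frac12$ for all $n\ge1$, and put $s_n=\lambda_1\cdots\lambda_n$ ($s_0=1$). Start from the unit square $Q_0=[0,1]\times[0,1]\subset\mathbb{C}$, $\mathcal{D}_0=\{Q_0\}$; given the family $\mathcal{D}_{n-1}$ of $4^{n-1}$ closed squares of side $s_{n-1}$, replace each of them by its four closed corner squares of side $s_n$ (sides parallel to the axes, one vertex in common with the larger square) to obtain the family $\mathcal{D}_n$ of $4^n$ squares. Let $K=\bigcap_{n}\bigcup_{Q\in\mathcal{D}_n}Q$, let $\mu$ be the Borel probability measure on $K$ with $\mu(Q)=4^{-n}$ for every $Q\in\mathcal{D}_n$, and let $a_n=\frac{1}{4^n s_n}$. For $x\in K$ let $Q_n(x)$ be the square of $\mathcal{D}_n$ containing $x$, and set $$T_n(x)=\int_{K\setminus Q_n(x)}\frac{1}{x-y}\,d\mu(y),\qquad S_n(x)=\frac{1}{\mu(Q_n(x))}\int_{Q_n(x)}T_n\,d\mu,\qquad n=0,1,2,\dots$$ Suppose that $\lim_{n\to\infty}a_n=0$, and let $E$ be the set of points $x\in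 K$ for which the sequence $(S_n(x))_{n\ge0}$ converges in $\mathbb{C}$. Then: 1. $\dim E\ge 1$, where $\dim$ is Hausdorff dimension; 2. if $\dim K=1$, then $\dim E=1$; 3. if $\sum_n a_n^2=\infty$, then $\dim E=1$ and, moreover, for every $z_0\in\mathbb{C}$ the set $\{x\in K:\lim_{n\to\infty}S_n(x)=z_0\}$ has Hausdorff dimension $1$. -/

import Mathlib

open MeasureTheory Filter Topology Complex

noncomputable section

namespace CantorCauchy

/-- Side length `s_n = lam 1 * ⋯ * lam n` of the squares of generation `n`. The value `lam 0` is
never used. -/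
def side (lam : ℕ → ℝ) (n : ℕ) : ℝ := ∏ k ∈ Finset.range n, lam (k + 1)

/-- Inside a square of generation `k` and side `s_k`, the lower left vertices of the four corner
squares of side `s_{k+1}` have coordinates `0` or `s_k - s_{k+1}` relative to the lower left vertex
of the big square. -/
def offset (lam : ℕ → ℝ) (k : ℕ) (b : Bool) : ℝ :=
  if b then side lam k - side lam (k + 1) else 0

/-- Lower left vertex of the square of generation `n` that is reached from the unit square by
choosing at step `k < n` the corner square `w k` (the first bit tells left / right, the second one
bottom / top). Only the first `n` letters of `w` matter. -/
def corner (lam : ℕ → ℝ) (n : ℕ) (w : ℕ → Bool × Bool) : ℂ :=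
  ⟨∑ k ∈ Finset.range n, offset lam k (w k).1, ∑ k ∈ Finset.range n, offset lam k (w k).2⟩

/-- The closed square with sides parallel to the axes, lower left vertex `c` and side length `s`. -/
def square (c : ℂ) (s : ℝ) : Set ℂ := Set.Icc c.re (c.re + s) ×ℂ Set.Icc c.im (c.im + s)

/-- The family `𝒟_n` of the `4 ^ n` squares of generation `n`. -/
def squares (lam : ℕ → ℝ) (n : ℕ) : Set (Set ℂ) :=
  {Q | ∃ w : ℕ → Bool × Bool, Q = square (corner lam n w) (side lam n)}

/-- The Cantor set `K = ⋂ n, ⋃ Q ∈ 𝒟_n, Q`. -/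
def cantorSet (lam : ℕ → ℝ) : Set ℂ := ⋂ n : ℕ, ⋃ Q ∈ squares lam n, Q

/-- The point of the Cantor set that is coded by the infinite word `w`: the limit of the vertices
`corner lam n w`. -/
def point (lam : ℕ → ℝ) (w : ℕ → Bool × Bool) : ℂ :=
  ⟨∑' k, offset lam k (w k).1, ∑' k, offset lam k (w k).2⟩

/-- The canonical measure `μ` of the Cantor set: the law of the point coded by a sequence of
independent letters, each uniformly distributed among the four corners. By
`cantorMeasure_spec` below it is the Borel probability measure on `K` that gives mass
`4 ^ (-n)` to each square of generation `n`. -/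
def cantorMeasure (lam : ℕ → ℝ) : Measure ℂ :=
  (Measure.infinitePi fun _ : ℕ => (PMF.uniformOfFintype (Bool × Bool)).toMeasure).map (point lam)

/-- The linear density `a_n = 1 / (4 ^ n * s_n)` at generation `n`. -/
def density (lam : ℕ → ℝ) (n : ℕ) : ℝ := 1 / (4 ^ n * side lam n)

/-- `Q_n(x)`, the square of generation `n` that contains `x`. (For `lam < 1 / 2` squares of the same
generation are disjoint, so that the union has exactly one member if `x ∈ K`.) -/
def squareAt (lam : ℕ → ℝ) (n : ℕ) (x : ℂ) : Set ℂ := ⋃₀ {Q | Q ∈ squares lam n ∧ x ∈ Q}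

/-- The Cauchy integral truncated at generation `n`,
`T_n(x) = ∫_{K \ Q_n(x)} 1 / (x - y) dμ(y)`. -/
def truncCauchy (lam : ℕ → ℝ) (n : ℕ) (x : ℂ) : ℂ :=
  ∫ y in cantorSet lam \ squareAt lam n x, 1 / (x - y) ∂(cantorMeasure lam)

/-- `S_n(x)`, the `μ`-average of `T_n` over `Q_n(x)`. -/
def mart (lam : ℕ → ℝ) (n : ℕ) (x : ℂ) : ℂ :=
  ⨍ z in squareAt lam n x, truncCauchy lam n z ∂(cantorMeasure lam)

/-! Verification that `cantorMeasure` is the canonical measure. -/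

section Spec

variable {lam : ℕ → ℝ} {L : ℝ}

theorem side_pos (h : ∀ n, 1 ≤ n → 1 / 4 ≤ lam n ∧ lam n ≤ L) (n : ℕ) : 0 < side lam n :=
  Finset.prod_pos fun k _ => lt_of_lt_of_le (by norm_num) (h (k + 1) (by omega)).1

theorem side_succ_lt (hL : L < 1 / 2) (h : ∀ n, 1 ≤ n → 1 / 4 ≤ lam n ∧ lam n ≤ L) (n : ℕ) :
    2 * side lam (n + 1) < side lam n := by
  have h0 := side_pos h n
  have h1 := (h (n + 1) (by omega)).2
  rw [side, Finset.prod_range_succ, ← side]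
  nlinarith

theorem side_tendsto (hL : L < 1 / 2) (h : ∀ n, 1 ≤ n → 1 / 4 ≤ lam n ∧ lam n ≤ L) :
    Tendsto (side lam) atTop (𝓝 0) := by
  refine squeeze_zero (fun n => (side_pos h n).le) (g := fun n => (1 / 2 : ℝ) ^ n) ?_
    (tendsto_pow_atTop_nhds_zero_of_lt_one (by norm_num) (by norm_num))
  intro n
  induction n with
  | zero => simp [side]
  | succ n ih =>
    have := side_succ_lt hL h n
    rw [pow_succ]
    linarith

theorem offset_bounds (hL : L < 1 / 2) (h : ∀ n, 1 ≤ n → 1 / 4 ≤ lam n ∧ lam n ≤ L) (k : ℕ)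
    (b : Bool) : 0 ≤ offset lam k b ∧ offset lam k b ≤ side lam k - side lam (k + 1) := by
  have h0 := side_succ_lt hL h k
  have h1 := side_pos h (k + 1)
  cases b <;> simp [offset] <;> linarith

theorem hasSum_gap (hL : L < 1 / 2) (h : ∀ n, 1 ≤ n → 1 / 4 ≤ lam n ∧ lam n ≤ L) (n : ℕ) :
    HasSum (fun k => side lam (k + n) - side lam (k + 1 + n)) (side lam n) := by
  rw [hasSum_iff_tendsto_nat_of_nonneg]
  · have h1 : Tendsto (fun m => side lam n - side lam (m + n)) atTop (𝓝 (side lam n - 0)) :=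
      ((side_tendsto hL h).comp (tendsto_add_atTop_nat n)).const_sub _
    rw [sub_zero] at h1
    refine h1.congr fun m => ?_
    rw [Finset.sum_range_sub' (fun k => side lam (k + n)), zero_add]
  · intro k
    have h0 := side_succ_lt hL h (k + n)
    have h1 := side_pos h (k + n + 1)
    rw [show k + 1 + n = k + n + 1 by omega]
    linarith

theorem summable_offset (hL : L < 1 / 2) (h : ∀ n, 1 ≤ n → 1 / 4 ≤ lam n ∧ lam n ≤ L)
    (e : ℕ → Bool) : Summable fun k => offset lam k (e k) :=
  Summable.of_nonneg_of_le (fun k => (offset_bounds hL h k _).1)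
    (fun k => (offset_bounds hL h k _).2) (by simpa using (hasSum_gap hL h 0).summable)

theorem tsum_offset_mem_of_eq (hL : L < 1 / 2) (h : ∀ n, 1 ≤ n → 1 / 4 ≤ lam n ∧ lam n ≤ L)
    (e d : ℕ → Bool) (n : ℕ) (hed : ∀ k < n, e k = d k) :
    ∑' k, offset lam k (e k) ∈ Set.Icc (∑ k ∈ Finset.range n, offset lam k (d k))
      (∑ k ∈ Finset.range n, offset lam k (d k) + side lam n) := by
  have hs := summable_offset hL h e
  have h1 : ∑ k ∈ Finset.range n, offset lam k (d k) = ∑ k ∈ Finset.range n, offset lam k (e k) :=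
    Finset.sum_congr rfl fun k hk => by rw [hed k (Finset.mem_range.1 hk)]
  rw [h1, ← hs.sum_add_tsum_nat_add n]
  have h2 : 0 ≤ ∑' k, offset lam (k + n) (e (k + n)) :=
    tsum_nonneg fun k => (offset_bounds hL h _ _).1
  have h3 : ∑' k, offset lam (k + n) (e (k + n)) ≤ side lam n := by
    rw [← (hasSum_gap hL h n).tsum_eq]
    refine Summable.tsum_le_tsum (fun k => ?_) ((summable_nat_add_iff n).2 hs)
      (hasSum_gap hL h n).summable
    have := (offset_bounds hL h (k + n) (e (k + n))).2
    rwa [show k + 1 + n = k + n + 1 by omega]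
  constructor <;> linarith

theorem tsum_offset_mem_iff (hL : L < 1 / 2) (h : ∀ n, 1 ≤ n → 1 / 4 ≤ lam n ∧ lam n ≤ L)
    (e d : ℕ → Bool) (n : ℕ) :
    ∑' k, offset lam k (e k) ∈ Set.Icc (∑ k ∈ Finset.range n, offset lam k (d k))
      (∑ k ∈ Finset.range n, offset lam k (d k) + side lam n) ↔ ∀ k < n, e k = d k := by
  refine ⟨?_, tsum_offset_mem_of_eq hL h e d n⟩
  induction n with
  | zero => intro _ k hk; omega
  | succ n ih =>
    rintro ⟨h1, h2⟩
    rw [Finset.sum_range_succ] at h1 h2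
    have hb := offset_bounds hL h n (d n)
    have hlt := side_succ_lt hL h n
    have hpos := side_pos h (n + 1)
    have hn := ih ⟨by linarith, by linarith⟩
    have h3 := tsum_offset_mem_of_eq hL h e e (n + 1) (fun _ _ => rfl)
    have h4 : ∑ k ∈ Finset.range n, offset lam k (d k) =
        ∑ k ∈ Finset.range n, offset lam k (e k) :=
      Finset.sum_congr rfl fun k hk => by rw [hn k (Finset.mem_range.1 hk)]
    rw [Finset.sum_range_succ] at h3
    obtain ⟨h5, h6⟩ := h3
    intro k hk
    rcases Nat.lt_succ_iff_lt_or_eq.1 hk with hk | rfl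
    · exact hn k hk
    · have ht : offset lam k true = side lam k - side lam (k + 1) := by simp [offset]
      have hf : offset lam k false = 0 := by simp [offset]
      rw [h4] at h1 h2
      generalize ∑' k, offset lam k (e k) = t at h1 h2 h5 h6
      cases he : e k <;> cases hd : d k <;> rw [hd] at h1 h2 <;> rw [he] at h5 h6 <;>
        first
          | rfl
          | (exfalso; rw [ht] at *; rw [hf] at *; linarith)

theorem point_mem_square_iff (hL : L < 1 / 2) (h : ∀ n, 1 ≤ n → 1 / 4 ≤ lam n ∧ lam n ≤ L)
    (w v : ℕ → Bool × Bool) (n : ℕ) :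
    point lam w ∈ square (corner lam n v) (side lam n) ↔ ∀ k < n, w k = v k := by
  have h1 := tsum_offset_mem_iff hL h (fun k => (w k).1) (fun k => (v k).1) n
  have h2 := tsum_offset_mem_iff hL h (fun k => (w k).2) (fun k => (v k).2) n
  rw [square, Complex.mem_reProdIm]
  refine (and_congr h1 h2).trans ?_
  simp only [Prod.ext_iff]
  exact ⟨fun H k hk => ⟨H.1 k hk, H.2 k hk⟩, fun H => ⟨fun k hk => (H k hk).1,
    fun k hk => (H k hk).2⟩⟩

theorem measurable_point (hL : L < 1 / 2) (h : ∀ n, 1 ≤ n → 1 / 4 ≤ lam n ∧ lam n ≤ L) :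
    Measurable (point lam) := by
  have key : ∀ f : Bool × Bool → Bool,
      Measurable fun w : ℕ → Bool × Bool => ∑' k, offset lam k (f (w k)) := by
    intro f
    refine measurable_of_tendsto_metrizable
      (f := fun n (w : ℕ → Bool × Bool) => ∑ k ∈ Finset.range n, offset lam k (f (w k))) ?_ ?_
    · intro n
      refine Finset.measurable_fun_sum _ fun k _ => ?_
      exact (measurable_of_finite fun p : Bool × Bool => offset lam k (f p)).comp
        (measurable_pi_apply k)
    · rw [tendsto_pi_nhds]
      intro w
      exact (summable_offset hL h fun k => f (w k)).hasSum.tendsto_sum_nat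
  exact Complex.measurableEquivRealProd.symm.measurable.comp ((key Prod.fst).prodMk (key Prod.snd))

theorem measurableSet_square (c : ℂ) (s : ℝ) : MeasurableSet (square c s) :=
  (Complex.measurable_re measurableSet_Icc).inter (Complex.measurable_im measurableSet_Icc)

theorem finite_squares (lam : ℕ → ℝ) (n : ℕ) : (squares lam n).Finite := by
  refine (Set.finite_range fun u : Fin n → Bool × Bool => square (corner lam n fun k =>
    if hk : k < n then u ⟨k, hk⟩ else (false, false)) (side lam n)).subset ?_
  rintro _ ⟨w, rfl⟩
  refine ⟨fun k => w k, ?_⟩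
  have : corner lam n (fun k => if _ : k < n then w k else (false, false)) = corner lam n w := by
    unfold corner
    congr 1 <;>
    exact Finset.sum_congr rfl fun k hk => by simp [Finset.mem_range.1 hk]
  simp only [this]

theorem measurableSet_cantorSet (lam : ℕ → ℝ) : MeasurableSet (cantorSet lam) := by
  refine MeasurableSet.iInter fun n => (finite_squares lam n).measurableSet_biUnion ?_
  rintro _ ⟨w, rfl⟩
  exact measurableSet_square _ _

/-- `cantorMeasure lam` is a probability measure carried by the Cantor set which gives mass
`4 ^ (-n)` to each square of generation `n`. -/
theorem cantorMeasure_spec (hL : L < 1 / 2) (h : ∀ n, 1 ≤ n → 1 / 4 ≤ lam n ∧ lam n ≤ L) :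
    IsProbabilityMeasure (cantorMeasure lam) ∧ cantorMeasure lam (cantorSet lam)ᶜ = 0 ∧
      ∀ n, ∀ Q ∈ squares lam n, cantorMeasure lam Q = ((4 : ENNReal) ^ n)⁻¹ := by
  have hm := measurable_point hL h
  refine ⟨Measure.isProbabilityMeasure_map hm.aemeasurable, ?_, ?_⟩
  · rw [cantorMeasure, Measure.map_apply hm (measurableSet_cantorSet lam).compl]
    convert measure_empty (μ := Measure.infinitePi fun _ : ℕ =>
      (PMF.uniformOfFintype (Bool × Bool)).toMeasure)
    refine Set.eq_empty_of_forall_notMem fun w hw => hw ?_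
    exact Set.mem_iInter.2 fun n => Set.mem_biUnion ⟨w, rfl⟩
      ((point_mem_square_iff hL h w w n).2 fun _ _ => rfl)
  · rintro n Q ⟨v, rfl⟩
    rw [cantorMeasure, Measure.map_apply hm (measurableSet_square _ _)]
    have : point lam ⁻¹' square (corner lam n v) (side lam n) =
        Set.pi (Finset.range n : Set ℕ) fun k => {v k} := by
      ext w
      simp [point_mem_square_iff hL h]
    rw [this, Measure.infinitePi_pi _ (fun _ _ => measurableSet_singleton _)]
    simp [PMF.uniformOfFintype_apply, ENNReal.inv_pow]

end Spec

end CantorCauchy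

end

/-! Points of $K$ are coded by words of corners, and $S_n$ becomes a martingale in the word: the
Cauchy kernel is antisymmetric, so the part of it added between generations $n$ and $n+1$ has mean
zero over each square of generation $n$. Moreover $T_{n+1}-T_n=O(a_n)$ and $T_n$ oscillates by
$O(a_n)$ on such a square, so that $S_n=T_n+O(a_n)$ has increments $O(a_n)$
(`steerableMartingale_wordMart`).

If $\sum a_n<\infty$, then $S_n$ converges on all of $K$, and $\dim K\ge1$ because $s_n\ge4^{-n}$.
If the sum diverges, $S_n$ can be driven to any $z_0$. Repeating one letter forever leads to a
vertex of the current square; seen from it the square lies in one quadrant, so the real and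
imaginary parts of $T_{k+1}-T_k$ keep fixed signs and have size at least $c\,a_k$. Words are
therefore built from blocks of $q^2$ free letters followed by $Kq$ copies of the letter that points
towards $z_0$. By orthogonality of the increments and Chebyshev, at least $4^{q^2-1}$ free parts
move $S$ by only $O(q a_n)$, which the steering part outweighs once $K$ is large, unless $a$ more
than halves over the block (`exists_block`). A potential absorbs the halvings, and the distance to
$z_0$ tends to $0$. Steering letters are a fraction $O(1/q)$ of all letters, so these words form a
tree of almost full entropy, and its image in $K$ has dimension at least $r$ for any given $r<1$
(`exists_tree`, `le_dimH_range_point`).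

If $\sum a_n^2=\infty$, then $a_n\ge1/n$, that is $s_n\le n4^{-n}$, for infinitely many $n$;
covering $K$ at these generations gives $\dim K\le1$ (`dimH_cantorSet_le_one`). -/

noncomputable section

namespace CantorCauchy

/-! ### Steerable martingales and splicing of words -/

/-- The sign of a bit: `1` for `true`, `-1` for `false`. -/
def bitSign (b : Bool) : ℝ := if b then 1 else -1

/-- A complex martingale on the words over the four corners, with increments `O (a n)`, which moves
by a definite amount, in a direction determined by the letter, along a word that is eventually
constant. -/
structure SteerableMartingale (S : ℕ → (ℕ → Bool × Bool) → ℂ) (a : ℕ → ℝ) (C c : ℝ) : Prop where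
  congr : ∀ n v w, (∀ k < n, v k = w k) → S n v = S n w
  norm_step_le : ∀ n w, ‖S (n + 1) w - S n w‖ ≤ C * a n
  sum_update : ∀ n w, ∑ b, S (n + 1) (Function.update w n b) = 4 * S n w
  steer_re : ∀ n N w (b : Bool × Bool), (∀ k, n ≤ k → w k = b) →
    c * ∑ j ∈ Finset.range N, a (n + j) - C * a n ≤ bitSign b.1 * (S (n + N) w - S n w).re
  steer_im : ∀ n N w (b : Bool × Bool), (∀ k, n ≤ k → w k = b) →
    c * ∑ j ∈ Finset.range N, a (n + j) - C * a n ≤ -bitSign b.2 * (S (n + N) w - S n w).im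
  antitone : Antitone a
  nonneg : ∀ n, 0 ≤ a n
  C_pos : 0 < C
  c_pos : 0 < c

/-- Since `y` is the mean of `f`, the cross term with `y - z` vanishes: one step of martingale
orthogonality. -/
theorem sum_sq_dist_le {y z : ℂ} {d : ℝ} (f : Bool × Bool → ℂ) (hf : ∑ b, f b = 4 * y)
    (hd : ∀ b, ‖f b - y‖ ≤ d) : ∑ b, ‖f b - z‖ ^ 2 ≤ 4 * (‖y - z‖ ^ 2 + d ^ 2) := by
  have h1 : ∀ b, ‖f b - y‖ ^ 2 ≤ d ^ 2 := fun b => pow_le_pow_left₀ (norm_nonneg _) (hd b) 2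
  have hre := congrArg Complex.re hf
  have him := congrArg Complex.im hf
  have e1 := h1 (true, true)
  have e2 := h1 (true, false)
  have e3 := h1 (false, true)
  have e4 := h1 (false, false)
  simp only [Complex.sq_norm, Complex.normSq_apply, Fintype.sum_prod_type, Fintype.sum_bool,
    Complex.sub_re, Complex.sub_im, Complex.add_re, Complex.add_im, Complex.mul_re,
    Complex.mul_im, Complex.re_ofNat, Complex.im_ofNat, zero_mul, sub_zero, add_zero] at *
  have k1 := congrArg (fun t => t * (y.re - z.re)) hre
  have k2 := congrArg (fun t => t * (y.im - z.im)) him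
  linarith

/-- The word that starts with the first `n` letters of `w`, continues with `u` and ends with the
letter `b` repeated. -/
def splice (n : ℕ) (w : ℕ → Bool × Bool) {N : ℕ} (u : Fin N → Bool × Bool) (b : Bool × Bool) :
    ℕ → Bool × Bool :=
  fun j => if j < n then w j else if h : j - n < N then u ⟨j - n, h⟩ else b

theorem splice_of_lt {n : ℕ} {w : ℕ → Bool × Bool} {N : ℕ} {u : Fin N → Bool × Bool}
    {b : Bool × Bool} {j : ℕ} (h : j < n) : splice n w u b j = w j := by simp [splice, h]

theorem splice_add {n : ℕ} {w : ℕ → Bool × Bool} {N : ℕ} {u : Fin N → Bool × Bool}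
    {b : Bool × Bool} (i : Fin N) : splice n w u b (n + i) = u i := by simp [splice]

theorem splice_of_le {n : ℕ} {w : ℕ → Bool × Bool} {N : ℕ} {u : Fin N → Bool × Bool}
    {b : Bool × Bool} {j : ℕ} (h : n + N ≤ j) : splice n w u b j = b := by
  have h1 : ¬ j < n := by omega
  have h2 : ¬ j - n < N := by omega
  simp [splice, h1, h2]

theorem splice_congr {n : ℕ} {w : ℕ → Bool × Bool} {N : ℕ} {u : Fin N → Bool × Bool}
    {b b' : Bool × Bool} {j : ℕ} (h : j < n + N) : splice n w u b j = splice n w u b' j := by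
  by_cases h1 : j < n
  · simp [splice, h1]
  · have h2 : j - n < N := by omega
    simp [splice, h1, h2]

theorem splice_snoc {n : ℕ} {w : ℕ → Bool × Bool} {N : ℕ} {u : Fin N → Bool × Bool}
    {b d : Bool × Bool} :
    splice n w (Fin.snoc u b : Fin (N + 1) → Bool × Bool) d =
      Function.update (splice n w u d) (n + N) b := by
  funext j
  rcases lt_trichotomy j (n + N) with h | rfl | h
  · rw [Function.update_of_ne h.ne]
    by_cases h1 : j < n
    · simp [splice, h1]
    · have h2 : j - n < N := by omega
      have h3 : j - n < N + 1 := by omega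
      simp [splice, h1, h2, h3, Fin.snoc]
  · simp [splice, Fin.snoc]
  · rw [Function.update_of_ne h.ne', splice_of_le (by omega), splice_of_le (by omega)]

/-! ### One block: free letters, then steering letters -/

namespace SteerableMartingale

variable {S : ℕ → (ℕ → Bool × Bool) → ℂ} {a : ℕ → ℝ} {C c : ℝ}

theorem norm_sub_le (hS : SteerableMartingale S a C c) (n N : ℕ) (w : ℕ → Bool × Bool) :
    ‖S (n + N) w - S n w‖ ≤ C * N * a n := by
  induction N with
  | zero => simp
  | succ N ih =>
    have h1 := hS.norm_step_le (n + N) w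
    have h2 := hS.antitone (show n ≤ n + N by omega)
    have h3 := norm_sub_le_norm_sub_add_norm_sub (S (n + N + 1) w) (S (n + N) w) (S n w)
    have h4 := mul_le_mul_of_nonneg_left h2 hS.C_pos.le
    rw [← add_assoc]
    push_cast
    nlinarith

/-- Variances of martingale increments add up; the induction peels off the last letter. The filler
`d` is irrelevant, as `S (n + N)` reads only the first `n + N` letters. -/
theorem sum_sq_norm_le (hS : SteerableMartingale S a C c) (n N : ℕ) (w : ℕ → Bool × Bool)
    (d : Bool × Bool) :
    ∑ u : Fin N → Bool × Bool, ‖S (n + N) (splice n w u d) - S n w‖ ^ 2 ≤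
      4 ^ N * (N * (C * a n) ^ 2) := by
  induction N with
  | zero =>
    have (u : Fin 0 → Bool × Bool) : S n (splice n w u d) = S n w :=
      hS.congr _ _ _ fun k hk => splice_of_lt hk
    rw [Fintype.sum_unique, add_zero, this]
    simp
  | succ N ih =>
    rw [← (Fin.snocEquiv fun _ : Fin (N + 1) => Bool × Bool).sum_comp, Fintype.sum_prod_type_right]
    calc _ ≤ ∑ u : Fin N → Bool × Bool,
          4 * (‖S (n + N) (splice n w u d) - S n w‖ ^ 2 + (C * a n) ^ 2) := by
          refine Finset.sum_le_sum fun u _ => ?_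
          refine le_of_eq_of_le ?_ (sum_sq_dist_le (z := S n w) _
            (hS.sum_update (n + N) (splice n w u d)) (d := C * a n) fun b => ?_)
          · refine Finset.sum_congr rfl fun b _ => ?_
            rw [← splice_snoc]
            rfl
          · have h1 := hS.norm_step_le (n + N) (Function.update (splice n w u d) (n + N) b)
            rw [hS.congr (n + N) (Function.update (splice n w u d) (n + N) b) (splice n w u d)
              fun k hk => Function.update_of_ne hk.ne _ _] at h1
            exact h1.trans (mul_le_mul_of_nonneg_left (hS.antitone (by omega)) hS.C_pos.le)
      _ = 4 * (∑ u : Fin N → Bool × Bool, ‖S (n + N) (splice n w u d) - S n w‖ ^ 2) +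
          4 ^ (N + 1) * (C * a n) ^ 2 := by
          rw [← Finset.mul_sum, Finset.sum_add_distrib]
          simp
          ring
      _ ≤ _ := by
          push_cast
          rw [pow_succ]
          nlinarith

/-- Chebyshev: the mean square displacement is at most $q^2(Ca_n)^2$, so a displacement above
$2Cqa_n$ occurs for at most a quarter of the $4^{q^2}$ words. More than enough words remain. -/
theorem exists_embedding_free (hS : SteerableMartingale S a C c) (q n : ℕ) (hq : 1 ≤ q)
    (w : ℕ → Bool × Bool) (d : Bool × Bool) (ha : 0 < a n) :
    ∃ f : Fin (4 ^ (q ^ 2 - 1)) ↪ (Fin (q ^ 2) → Bool × Bool),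
      ∀ i, ‖S (n + q ^ 2) (splice n w (f i) d) - S n w‖ ≤ 2 * C * q * a n := by
  classical
  set D : (Fin (q ^ 2) → Bool × Bool) → ℝ :=
    fun u => ‖S (n + q ^ 2) (splice n w u d) - S n w‖
  let G : Finset (Fin (q ^ 2) → Bool × Bool) := {u | D u ≤ 2 * C * q * a n}
  have hpos : 0 < 2 * C * q * a n := by
    have := hS.C_pos
    have : (0 : ℝ) < q := by exact_mod_cast hq
    positivity
  have hbad : (4 * (C * q * a n) ^ 2) * (Gᶜ.card : ℝ) ≤ 4 ^ (q ^ 2) * (q ^ 2 * (C * a n) ^ 2) := by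
    calc (4 * (C * q * a n) ^ 2) * (Gᶜ.card : ℝ) = ∑ u ∈ Gᶜ, 4 * (C * q * a n) ^ 2 := by
          simp [mul_comm]
      _ ≤ ∑ u ∈ Gᶜ, D u ^ 2 := by
          refine Finset.sum_le_sum fun u hu => ?_
          have : 2 * C * q * a n < D u := by simpa [G] using hu
          nlinarith
      _ ≤ ∑ u, D u ^ 2 :=
          Finset.sum_le_sum_of_subset_of_nonneg (Finset.subset_univ _) fun _ _ _ => sq_nonneg _
      _ ≤ _ := by exact_mod_cast hS.sum_sq_norm_le n (q ^ 2) w d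
  have hcard : (G.card : ℝ) + Gᶜ.card = 4 ^ (q ^ 2) := by
    have := Finset.card_add_card_compl G
    rw [← Nat.cast_add, this]
    simp
  have hbad' : 4 * (Gᶜ.card : ℝ) ≤ 4 ^ (q ^ 2) := by
    have h1 : 0 < (C * q * a n) ^ 2 := by
      have : C * q * a n = (2 * C * q * a n) / 2 := by ring
      rw [this]
      positivity
    refine le_of_mul_le_mul_left ?_ h1
    calc _ = (4 * (C * q * a n) ^ 2) * (Gᶜ.card : ℝ) := by ring
      _ ≤ _ := hbad
      _ = _ := by ring
  have hq2 : 4 ^ (q ^ 2) = (4 : ℝ) * 4 ^ (q ^ 2 - 1) := by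
    rw [← pow_succ']
    congr 1
    have : 1 ≤ q ^ 2 := Nat.one_le_pow _ _ hq
    omega
  have hle : 4 ^ (q ^ 2 - 1) ≤ G.card := by
    have h2 : (4 : ℝ) ^ (q ^ 2 - 1) ≤ G.card := by
      have : (0 : ℝ) < 4 ^ (q ^ 2 - 1) := by positivity
      linarith
    exact_mod_cast h2
  obtain ⟨f⟩ := Function.Embedding.nonempty_of_card_le (α := Fin (4 ^ (q ^ 2 - 1))) (β := G)
    (by simpa using hle)
  refine ⟨f.trans (Function.Embedding.subtype _), fun i => ?_⟩
  exact (Finset.mem_filter.1 (f i).2).2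

/-- A step `v` towards `0` either shortens `|x|` by `v` or overshoots by at most `C'`. -/
theorem abs_sub_bitSign_mul_le {x v C' : ℝ} (hv : v ≤ C') :
    |x - bitSign (decide (0 ≤ x)) * v| ≤ max (|x| - v) C' := by
  by_cases hx : 0 ≤ x
  · simp only [bitSign, hx, decide_true, if_true, one_mul, abs_of_nonneg hx]
    rw [abs_le]
    constructor
    · have := le_max_right (x - v) C'
      linarith
    · exact le_max_left _ _
  · simp only [bitSign, hx, decide_false, Bool.false_eq_true, if_false, abs_of_neg (not_le.1 hx)]
    rw [abs_le]
    push Not at hx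
    have h1 := le_max_right (-x - v) C'
    have h2 := le_max_left (-x - v) C'
    constructor <;> linarith

theorem abs_bitSign (b : Bool) : |bitSign b| = 1 := by cases b <;> simp [bitSign]

theorem bitSign_mul_self (b : Bool) : bitSign b * bitSign b = 1 := by cases b <;> simp [bitSign]

/-- How one coordinate of the distance to the target evolves over one block. -/
theorem coordinate_block_bound {x y t α α' C c : ℝ} {q K : ℕ} (hq : 1 ≤ q) (hC : 0 < C)
    (hα : 0 ≤ α) (hc : 0 < c) (hK : 2 * (3 * C + 1) ≤ c * K)
    (hxy : |y - x| ≤ 2 * C * q * α) (ht : |t| ≤ C * (K * q) * α)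
    (hsteer : c * (K * q) * α' - C * α ≤ bitSign (decide (0 ≤ y)) * t) :
    |y - t| ≤ |x| + C * (K + 2) * q * α ∧
      (α ≤ 2 * α' → |y - t| ≤ max (|x| - α) (C * (K + 2) * q * α)) := by
  have hq' : (1 : ℝ) ≤ q := by exact_mod_cast hq
  have h1 : |y| ≤ |x| + 2 * C * q * α := by
    have := abs_sub_abs_le_abs_sub y x
    linarith
  constructor
  · have := abs_sub y t
    nlinarith
  · intro hgood
    set s := bitSign (decide (0 ≤ y))
    have hst : t = s * (s * t) := by rw [← mul_assoc, bitSign_mul_self, one_mul]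
    have hv : s * t ≤ C * (K * q) * α := by
      refine (le_abs_self _).trans ?_
      rw [abs_mul, abs_bitSign, one_mul]
      exact ht
    -- Steering gains at least $cKq\alpha/2\ge(3C+1)q\alpha$, the half coming from `hgood`. Of this,
    -- $C\alpha$ pays for the steering error and $2Cq\alpha$ for the free displacement; a net gain
    -- of $\alpha$ is left.
    have hv1 : (2 * C * q + 1) * α ≤ s * t := by
      refine le_trans ?_ hsteer
      have e1 : c * (K * q) * α ≤ 2 * (c * (K * q) * α') := by
        have : 0 ≤ c * (K * q) := by positivity
        nlinarith
      have e2 : 2 * (3 * C + 1) * q * α ≤ c * (K * q) * α := by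
        have : 0 ≤ q * α := by positivity
        nlinarith
      have e3 : α ≤ q * α := by nlinarith
      have e4 : C * α ≤ C * (q * α) := mul_le_mul_of_nonneg_left e3 hC.le
      linarith
    have hv0 : 0 ≤ s * t := le_trans (by positivity) hv1
    rw [hst]
    refine (abs_sub_bitSign_mul_le hv).trans (max_le_max ?_ ?_)
    · linarith
    · have : 0 ≤ C * q * α := by positivity
      linarith

theorem mul_le_sum_antitone {a : ℕ → ℝ} (ha : Antitone a) (n N M : ℕ) (h : n + N ≤ M) :
    N * a M ≤ ∑ j ∈ Finset.range N, a (n + j) := by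
  have := Finset.card_nsmul_le_sum (Finset.range N) (fun j => a (n + j)) (a M) fun j hj =>
    ha (by have := Finset.mem_range.1 hj; omega)
  simpa using this

/-- The steering letter is chosen after the free part, from the quadrant of the remaining
displacement. Different blocks already differ in their free parts. -/
theorem exists_block (hS : SteerableMartingale S a C c) (hpos : ∀ n, 0 < a n) {q K : ℕ}
    (hq : 1 ≤ q) (hK : 2 * (3 * C + 1) ≤ c * K) (z : ℂ) (n : ℕ) (w : ℕ → Bool × Bool) :
    ∃ f : Fin (4 ^ (q ^ 2 - 1)) → ℕ → Bool × Bool,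
      (∀ i, ∀ k < n, f i k = w k) ∧
      (∀ i j, i ≠ j → ∃ k < n + (q ^ 2 + K * q), f i k ≠ f j k) ∧
      ∀ i, ∀ φ ∈ ({Complex.re, Complex.im} : Set (ℂ → ℝ)),
        |φ (z - S (n + (q ^ 2 + K * q)) (f i))| ≤ |φ (z - S n w)| + C * (K + 2) * q * a n ∧
        (a n ≤ 2 * a (n + (q ^ 2 + K * q)) → |φ (z - S (n + (q ^ 2 + K * q)) (f i))| ≤
          max (|φ (z - S n w)| - a n) (C * (K + 2) * q * a n)) := by
  obtain ⟨f, hf⟩ := hS.exists_embedding_free q n hq w (true, true) (hpos n)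
  let y : Fin (4 ^ (q ^ 2 - 1)) → ℂ :=
    fun i => z - S (n + q ^ 2) (splice n w (f i) (true, true))
  -- The second bit is negated because inversion $x\mapsto1/x$ reverses the sign of the imaginary
  -- part.
  let d : Fin (4 ^ (q ^ 2 - 1)) → Bool × Bool :=
    fun i => (decide (0 ≤ (y i).re), !decide (0 ≤ (y i).im))
  refine ⟨fun i => splice n w (f i) (d i), fun i k hk => splice_of_lt hk, ?_, ?_⟩
  · intro i j hij
    by_contra! H
    refine hij (f.injective (funext fun l => ?_))
    have := H (n + l) (by have := l.2; omega)
    rwa [splice_add, splice_add] at this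
  · intro i
    set v := splice n w (f i) (d i) with hv
    have hyv : S (n + q ^ 2) (splice n w (f i) (true, true)) = S (n + q ^ 2) v :=
      hS.congr _ _ _ fun k hk => splice_congr hk
    have hy : y i = z - S (n + q ^ 2) v := by rw [← hyv]
    have hfree : ‖y i - (z - S n w)‖ ≤ 2 * C * q * a n := by
      have := hf i
      rw [hyv] at this
      rw [hy, show z - S (n + q ^ 2) v - (z - S n w) = -(S (n + q ^ 2) v - S n w) by ring, norm_neg]
      exact this
    set t := S (n + q ^ 2 + K * q) v - S (n + q ^ 2) v with ht
    have hend : z - S (n + (q ^ 2 + K * q)) v = y i - t := by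
      rw [hy, ht, add_assoc]
      ring
    have ham := hS.antitone (show n ≤ n + q ^ 2 by omega)
    have hCa : C * a (n + q ^ 2) ≤ C * a n := mul_le_mul_of_nonneg_left ham hS.C_pos.le
    have htn : ‖t‖ ≤ C * (K * q) * a n := by
      have h1 := hS.norm_sub_le (n + q ^ 2) (K * q) v
      push_cast at h1
      refine h1.trans (mul_le_mul_of_nonneg_left ham ?_)
      have := hS.C_pos
      positivity
    have hsum : c * (K * q) * a (n + (q ^ 2 + K * q)) ≤
        c * ∑ j ∈ Finset.range (K * q), a (n + q ^ 2 + j) := by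
      rw [mul_assoc]
      refine mul_le_mul_of_nonneg_left ?_ hS.c_pos.le
      exact_mod_cast mul_le_sum_antitone hS.antitone (n + q ^ 2) (K * q) _ (by omega)
    have htail : ∀ k, n + q ^ 2 ≤ k → v k = d i := fun k hk => splice_of_le hk
    have hre := hS.steer_re (n + q ^ 2) (K * q) v (d i) htail
    have him := hS.steer_im (n + q ^ 2) (K * q) v (d i) htail
    have hneg : -bitSign (d i).2 = bitSign (decide (0 ≤ (y i).im)) := by
      by_cases h : 0 ≤ (y i).im <;> simp [d, bitSign, h]
    rw [hneg] at him
    rintro φ (rfl | rfl)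
    · rw [hend, Complex.sub_re]
      refine coordinate_block_bound hq hS.C_pos (hS.nonneg n) hS.c_pos hK ?_ ?_ ?_
      · exact (Complex.abs_re_le_norm (y i - (z - S n w))).trans hfree
      · exact (Complex.abs_re_le_norm t).trans htn
      · exact le_trans (by linarith) hre
    · rw [hend, Complex.sub_im]
      refine coordinate_block_bound hq hS.C_pos (hS.nonneg n) hS.c_pos hK ?_ ?_ ?_
      · exact (Complex.abs_im_le_norm (y i - (z - S n w))).trans hfree
      · exact (Complex.abs_im_le_norm t).trans htn
      · exact le_trans (by linarith) him

end SteerableMartingale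

/-! ### Convergence from the block recursion -/

/-- A nonnegative sequence that decreases by `α k` unless it is already `O (α k)` tends to `0`. -/
theorem tendsto_zero_of_decrease {y α : ℕ → ℝ} {B : ℝ} (hy : ∀ k, 0 ≤ y k)
    (hα : ∀ k, 0 ≤ α k) (hα0 : Tendsto α atTop (𝓝 0)) (hs : ¬ Summable α)
    (hstep : ∀ k, y (k + 1) ≤ max (y k - α k) (B * α k)) : Tendsto y atTop (𝓝 0) := by
  rw [Metric.tendsto_atTop]
  intro ε hε
  have hBα : Tendsto (fun k => B * α k) atTop (𝓝 0) := by simpa using hα0.const_mul B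
  obtain ⟨k₀, hk₀⟩ := eventually_atTop.1 (hBα.eventually (gt_mem_nhds (half_pos hε)))
  have habs : ∀ k ≥ k₀, y k ≤ ε / 2 → y (k + 1) ≤ ε / 2 := fun k hk h =>
    (hstep k).trans (max_le (by linarith [hα k]) (hk₀ k hk).le)
  -- If `y` stayed above `ε / 2`, every step from `k₀` on would be a genuine decrease, and the sum
  -- of `α` would be bounded by `y k₀`.
  have hex : ∃ k ≥ k₀, y k ≤ ε / 2 := by
    by_contra! H
    refine hs ((summable_nat_add_iff k₀).1 ?_)
    refine summable_of_sum_range_le (c := y k₀) (fun k => hα _) fun N => ?_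
    have : ∀ N, ∑ i ∈ Finset.range N, α (i + k₀) + y (N + k₀) ≤ y k₀ := by
      intro N
      induction N with
      | zero => simp
      | succ N ih =>
        have h1 := hstep (N + k₀)
        rw [show N + k₀ + 1 = N + 1 + k₀ by omega] at h1
        rcases le_max_iff.1 h1 with h | h
        · rw [Finset.sum_range_succ]
          linarith
        · have := H (N + 1 + k₀) (by omega)
          have := hk₀ (N + k₀) (by omega)
          linarith
    linarith [this N, hy (N + k₀)]
  obtain ⟨k₁, hk₁, hy₁⟩ := hex
  refine ⟨k₁, fun k hk => ?_⟩
  have : y k ≤ ε / 2 := by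
    induction k, hk using Nat.le_induction with
    | base => exact hy₁
    | succ k hk ih => exact habs k (by omega) ih
  rw [Real.dist_eq, sub_zero, abs_of_nonneg (hy k)]
  linarith

/-- The potential $x_k+(2B+2)\alpha_k$ decreases properly. When $\alpha$ more than halves, the
second term drops by at least $(B+1)\alpha_k$, which pays for the possible increase $B\alpha_k$ of
$x$ and still leaves $\alpha_k$. -/
theorem tendsto_zero_of_block_bound {x α : ℕ → ℝ} {B : ℝ} (hB : 0 ≤ B) (hx : ∀ k, 0 ≤ x k)
    (hα : ∀ k, 0 ≤ α k) (hanti : Antitone α) (hα0 : Tendsto α atTop (𝓝 0)) (hs : ¬ Summable α)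
    (hstep : ∀ k, x (k + 1) ≤ x k + B * α k)
    (hgood : ∀ k, α k ≤ 2 * α (k + 1) → x (k + 1) ≤ max (x k - α k) (B * α k)) :
    Tendsto x atTop (𝓝 0) := by
  have h : Tendsto (fun k => x k + (2 * B + 2) * α k) atTop (𝓝 0) := by
    refine tendsto_zero_of_decrease (α := α) (B := 3 * B + 2)
      (fun k => add_nonneg (hx k) (mul_nonneg (by positivity) (hα k))) hα hα0 hs fun k => ?_
    have h1 : (2 * B + 2) * α (k + 1) ≤ (2 * B + 2) * α k :=
      mul_le_mul_of_nonneg_left (hanti (by omega)) (by positivity)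
    by_cases hg : α k ≤ 2 * α (k + 1)
    · rcases le_max_iff.1 (hgood k hg) with h | h
      · exact le_max_of_le_left (by linarith)
      · exact le_max_of_le_right (by linarith)
    · refine le_max_of_le_left ?_
      push Not at hg
      have h2 := mul_le_mul_of_nonneg_left hg.le (show 0 ≤ B + 1 by positivity)
      linarith [hstep k]
  exact squeeze_zero hx (fun k => le_add_of_nonneg_right (mul_nonneg (by positivity) (hα k))) h

/-- By monotonicity each block of length `M` sums to at most `M` times its first term. -/
theorem not_summable_block {a : ℕ → ℝ} (ha : Antitone a) (h0 : ∀ n, 0 ≤ a n) (hs : ¬ Summable a)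
    {M : ℕ} (hM : 0 < M) : ¬ Summable fun k => a (k * M) := by
  intro H
  refine hs (summable_of_sum_range_le (c := M * ∑' k, a (k * M)) h0 fun N => ?_)
  have h1 : ∀ N, ∑ i ∈ Finset.range (N * M), a i ≤ M * ∑ k ∈ Finset.range N, a (k * M) := by
    intro N
    induction N with
    | zero => simp
    | succ N ih =>
      rw [Nat.succ_mul, Finset.sum_range_add, Finset.sum_range_succ, mul_add]
      refine add_le_add ih ?_
      have := Finset.sum_le_card_nsmul (Finset.range M) (fun j => a (N * M + j)) (a (N * M))
        fun j _ => ha (by omega)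
      simpa using this
  calc ∑ i ∈ Finset.range N, a i ≤ ∑ i ∈ Finset.range (N * M), a i :=
        Finset.sum_le_sum_of_subset_of_nonneg
          (Finset.range_mono (Nat.le_mul_of_pos_right N hM)) fun _ _ _ => h0 _
    _ ≤ M * ∑ k ∈ Finset.range N, a (k * M) := h1 N
    _ ≤ _ := mul_le_mul_of_nonneg_left (H.sum_le_tsum _ fun _ _ => h0 _) (Nat.cast_nonneg M)

/-! ### Trees of words -/

section Tree

variable {A : Type*} {m M : ℕ} (f : ℕ → (ℕ → A) → Fin m → ℕ → A) (w₀ : ℕ → A)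

/-- The words obtained by choosing successively, according to the digits `g`, among the `m`
extensions that `f` offers. -/
def treeWord (g : ℕ → Fin m) : ℕ → ℕ → A
  | 0 => w₀
  | k + 1 => f k (treeWord g k) (g k)

/-- The infinite word coded by the digits `g`. -/
def treeLimit (g : ℕ → Fin m) (j : ℕ) : A := treeWord f w₀ g (j + 1) j

variable {f w₀}

theorem treeWord_eq_of_le (hf : ∀ k w i, ∀ j < k * M, f k w i j = w j) (g : ℕ → Fin m) {k l : ℕ}
    (hkl : k ≤ l) {j : ℕ} (hj : j < k * M) : treeWord f w₀ g l j = treeWord f w₀ g k j := by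
  induction l, hkl using Nat.le_induction with
  | base => rfl
  | succ l hkl ih =>
    rw [treeWord, hf _ _ _ _ (hj.trans_le (Nat.mul_le_mul_right M hkl)), ih]

/-- Stage `k` fixes the first `k * M` letters for good, and as `M > 0` stage `j + 1` has already
fixed letter `j`. -/
theorem treeLimit_eq (hM : 0 < M) (hf : ∀ k w i, ∀ j < k * M, f k w i j = w j) (g : ℕ → Fin m)
    {k j : ℕ} (hj : j < k * M) : treeLimit f w₀ g j = treeWord f w₀ g k j := by
  rw [treeLimit]
  rcases le_total (j + 1) k with h | h
  · refine (treeWord_eq_of_le hf g h ?_).symm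
    exact (Nat.lt_succ_self j).trans_le (Nat.le_mul_of_pos_right _ hM)
  · exact treeWord_eq_of_le hf g h hj

theorem treeWord_congr {g h : ℕ → Fin m} {k : ℕ} (hgh : ∀ i < k, g i = h i) :
    treeWord f w₀ g k = treeWord f w₀ h k := by
  induction k with
  | zero => rfl
  | succ k ih => rw [treeWord, treeWord, ih fun i hi => hgh i (by omega), hgh k (by omega)]

/-- The quantitative injectivity on which the dimension bound rests. -/
theorem treeLimit_ne (hM : 0 < M) (hf : ∀ k w i, ∀ j < k * M, f k w i j = w j)
    (hne : ∀ k w i i', i ≠ i' → ∃ j < (k + 1) * M, f k w i j ≠ f k w i' j) {g h : ℕ → Fin m}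
    {k : ℕ} (hgh : ∀ i < k, g i = h i) (hk : g k ≠ h k) :
    ∃ j < (k + 1) * M, treeLimit f w₀ g j ≠ treeLimit f w₀ h j := by
  obtain ⟨j, hj, H⟩ := hne k (treeWord f w₀ g k) _ _ hk
  refine ⟨j, hj, ?_⟩
  rw [treeLimit_eq hM hf g hj, treeLimit_eq hM hf h hj, treeWord, treeWord, ← treeWord_congr hgh]
  exact H

end Tree

/-! ### Words of almost full entropy along which the martingale converges -/

/-- The overhead $Kq+1$ is of lower order than $q^2$: $q(1-r)\ge1+K$ gives $r(q^2+Kq)\le q^2-1$. -/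
theorem exists_block_length (K : ℕ) {r : ℝ} (hr : r < 1) :
    ∃ q : ℕ, 2 ≤ q ∧ (4 : ℝ) ^ (r * (q ^ 2 + K * q : ℕ)) ≤ (4 ^ (q ^ 2 - 1) : ℕ) := by
  obtain ⟨q, hq⟩ := exists_nat_ge (max 2 ((1 + K) / (1 - r)))
  have hq2 : 2 ≤ q := by exact_mod_cast (le_max_left _ _).trans hq
  refine ⟨q, hq2, ?_⟩
  have h1 := (le_max_right _ _).trans hq
  rw [div_le_iff₀ (by linarith)] at h1
  have hq' : (2 : ℝ) ≤ q := by exact_mod_cast hq2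
  rw [Nat.cast_pow, ← Real.rpow_natCast, Nat.cast_ofNat]
  refine Real.rpow_le_rpow_of_exponent_le (by norm_num) ?_
  rw [Nat.cast_sub (Nat.one_le_pow _ _ (by omega))]
  push_cast
  have h2 : (1 + K) * (q : ℝ) ≤ q * (1 - r) * q := by nlinarith
  have h3 : r * (K * q) ≤ K * q := mul_le_of_le_one_left (by positivity) hr.le
  nlinarith

/-- A steerable martingale whose increments tend to `0` but are not summable tends to any
prescribed limit along a set of words that has almost full entropy. -/
theorem SteerableMartingale.exists_tree {S : ℕ → (ℕ → Bool × Bool) → ℂ} {a : ℕ → ℝ} {C c : ℝ}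
    (hS : SteerableMartingale S a C c) (hpos : ∀ n, 0 < a n) (ha : Tendsto a atTop (𝓝 0))
    (hs : ¬ Summable a) (z : ℂ) {r : ℝ} (hr : r < 1) :
    ∃ (M m : ℕ) (φ : (ℕ → Fin m) → ℕ → Bool × Bool), 1 < m ∧ (4 : ℝ) ^ (r * M) ≤ m ∧
      (∀ g h k, (∀ i < k, g i = h i) → g k ≠ h k → ∃ j < (k + 1) * M, φ g j ≠ φ h j) ∧
      ∀ g, Tendsto (fun n => S n (φ g)) atTop (𝓝 z) := by
  obtain ⟨K, hK⟩ := exists_nat_ge (2 * (3 * C + 1) / c)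
  rw [div_le_iff₀' hS.c_pos] at hK
  obtain ⟨q, hq, hqr⟩ := exists_block_length K hr
  have hM : 0 < q ^ 2 + K * q := by positivity
  have hblock := fun k w => hS.exists_block hpos (q := q) (by omega) hK z (k * (q ^ 2 + K * q)) w
  obtain ⟨M, hMdef⟩ : ∃ M, M = q ^ 2 + K * q := ⟨_, rfl⟩
  obtain ⟨B, hBdef⟩ : ∃ B, B = C * (K + 2) * q := ⟨_, rfl⟩
  rw [← hMdef] at hqr hM
  simp only [← hMdef, ← hBdef] at hblock
  have hB : 0 ≤ B := by
    have := hS.C_pos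
    rw [hBdef]
    positivity
  choose f hf hne hb using hblock
  have hne' : ∀ k w i i', i ≠ i' → ∃ j < (k + 1) * M, f k w i j ≠ f k w i' j := by
    intro k w i i' h
    rw [Nat.succ_mul]
    exact hne k w i i' h
  let w₀ : ℕ → Bool × Bool := fun _ => (true, true)
  refine ⟨M, 4 ^ (q ^ 2 - 1), treeLimit f w₀, ?_, hqr,
    fun g h k hgh hk => treeLimit_ne hM hf hne' hgh hk, fun g => ?_⟩
  · refine Nat.one_lt_pow ?_ (by norm_num)
    have : 2 ^ 2 ≤ q ^ 2 := Nat.pow_le_pow_left hq 2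
    omega
  · set v := treeLimit f w₀ g
    have hSv : ∀ k, S (k * M) v = S (k * M) (treeWord f w₀ g k) := fun k =>
      hS.congr _ _ _ fun j hj => treeLimit_eq hM hf g hj
    have hcoord : ∀ φ ∈ ({Complex.re, Complex.im} : Set (ℂ → ℝ)),
        Tendsto (fun k => |φ (z - S (k * M) v)|) atTop (𝓝 0) := by
      intro φ hφ
      refine tendsto_zero_of_block_bound (α := fun k => a (k * M)) hB (fun _ => abs_nonneg _)
        (fun _ => hS.nonneg _) (fun k l h => hS.antitone (Nat.mul_le_mul_right M h))
        (ha.comp (tendsto_id.atTop_mul_const' hM)) (not_summable_block hS.antitone hS.nonneg hs hM)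
        (fun k => ?_) (fun k hk => ?_)
      · have := (hb k (treeWord f w₀ g k) (g k) φ hφ).1
        rw [hSv, hSv, Nat.succ_mul]
        exact this
      · rw [Nat.succ_mul] at hk
        have := (hb k (treeWord f w₀ g k) (g k) φ hφ).2 hk
        rw [hSv, hSv, Nat.succ_mul]
        exact this
    have hnorm : Tendsto (fun k => ‖z - S (k * M) v‖) atTop (𝓝 0) := by
      have := (hcoord _ (Or.inl rfl)).add (hcoord _ (Or.inr rfl))
      rw [add_zero] at this
      exact squeeze_zero (fun _ => norm_nonneg _) (fun k => Complex.norm_le_abs_re_add_abs_im _) this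
    have hdiv : Tendsto (fun n => n / M) atTop atTop := Nat.tendsto_div_const_atTop hM.ne'
    -- Convergence at block ends suffices: inside a block of length `M` the martingale moves by at
    -- most `C * M * a (n / M * M)`.
    have hall : Tendsto (fun n => ‖z - S (n / M * M) v‖ + C * M * a (n / M * M)) atTop (𝓝 0) := by
      have h1 : Tendsto (fun k => C * M * a (k * M)) atTop (𝓝 0) := by
        simpa using (ha.comp (tendsto_id.atTop_mul_const' hM)).const_mul (C * M)
      have := (hnorm.add h1).comp hdiv
      rw [add_zero] at this
      exact this
    rw [tendsto_iff_norm_sub_tendsto_zero]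
    refine squeeze_zero (fun _ => norm_nonneg _) (fun n => ?_) hall
    have h1 := hS.norm_sub_le (n / M * M) (n % M) v
    rw [Nat.div_add_mod'] at h1
    have h2 : C * (n % M : ℕ) * a (n / M * M) ≤ C * M * a (n / M * M) := by
      refine mul_le_mul_of_nonneg_right (mul_le_mul_of_nonneg_left ?_ hS.C_pos.le) (hS.nonneg _)
      exact_mod_cast (Nat.mod_lt _ hM).le
    have h3 := norm_sub_le_norm_sub_add_norm_sub (S n v) (S (n / M * M) v) z
    rw [norm_sub_rev (S (n / M * M) v) z] at h3
    linarith


/-! ### Separation of points of the Cantor set -/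

section Geometry

variable {lam : ℕ → ℝ} {L : ℝ}

theorem side_succ (lam : ℕ → ℝ) (n : ℕ) : side lam (n + 1) = side lam n * lam (n + 1) := by
  rw [side, Finset.prod_range_succ, ← side]

theorem side_antitone (hL : L < 1 / 2) (h : ∀ n, 1 ≤ n → 1 / 4 ≤ lam n ∧ lam n ≤ L) :
    Antitone (side lam) :=
  antitone_nat_of_succ_le fun n => by linarith [side_succ_lt hL h n, side_pos h (n + 1)]

theorem pow_le_side (h : ∀ n, 1 ≤ n → 1 / 4 ≤ lam n ∧ lam n ≤ L) (n : ℕ) :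
    ((4 : ℝ) ^ n)⁻¹ ≤ side lam n := by
  induction n with
  | zero => simp [side]
  | succ n ih =>
    rw [side_succ, pow_succ, mul_inv]
    have := (h (n + 1) (by omega)).1
    exact mul_le_mul ih (by linarith) (by norm_num) (side_pos h n).le

theorem gap_mul_side_le (h : ∀ n, 1 ≤ n → 1 / 4 ≤ lam n ∧ lam n ≤ L) (n : ℕ) :
    (1 - 2 * L) * side lam n ≤ side lam n - 2 * side lam (n + 1) := by
  rw [side_succ]
  have := (h (n + 1) (by omega)).2
  nlinarith [side_pos h n]

/-- The two sums lie in the two end intervals of length $s_{n+1}$ of a common interval of length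
$s_n$, which are $s_n-2s_{n+1}$ apart. -/
theorem gap_mul_side_le_tsum_sub (hL : L < 1 / 2) (h : ∀ n, 1 ≤ n → 1 / 4 ≤ lam n ∧ lam n ≤ L)
    {e d : ℕ → Bool} {n : ℕ} (hed : ∀ k < n, e k = d k) (he : e n = true) (hd : d n = false) :
    (1 - 2 * L) * side lam n ≤ ∑' k, offset lam k (e k) - ∑' k, offset lam k (d k) := by
  have h1 := (tsum_offset_mem_of_eq hL h e e (n + 1) fun _ _ => rfl).1
  have h2 := (tsum_offset_mem_of_eq hL h d d (n + 1) fun _ _ => rfl).2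
  rw [Finset.sum_range_succ] at h1 h2
  have h3 : ∑ k ∈ Finset.range n, offset lam k (e k) = ∑ k ∈ Finset.range n, offset lam k (d k) :=
    Finset.sum_congr rfl fun k hk => by rw [hed k (Finset.mem_range.1 hk)]
  have h4 : offset lam n (e n) = side lam n - side lam (n + 1) := by simp [offset, he]
  have h5 : offset lam n (d n) = 0 := by simp [offset, hd]
  have := gap_mul_side_le h n
  linarith

theorem abs_tsum_sub_le (hL : L < 1 / 2) (h : ∀ n, 1 ≤ n → 1 / 4 ≤ lam n ∧ lam n ≤ L)
    {e d : ℕ → Bool} {n : ℕ} (hed : ∀ k < n, e k = d k) :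
    |∑' k, offset lam k (e k) - ∑' k, offset lam k (d k)| ≤ side lam n := by
  have h1 := tsum_offset_mem_of_eq hL h e d n hed
  have h2 := tsum_offset_mem_of_eq hL h d d n fun _ _ => rfl
  rw [abs_le]
  constructor <;> linarith [h1.1, h1.2, h2.1, h2.2]

theorem gap_mul_side_le_abs_tsum_sub (hL : L < 1 / 2)
    (h : ∀ n, 1 ≤ n → 1 / 4 ≤ lam n ∧ lam n ≤ L) {e d : ℕ → Bool} {n : ℕ}
    (hed : ∀ k < n, e k = d k) (hne : e n ≠ d n) :
    (1 - 2 * L) * side lam n ≤ |∑' k, offset lam k (e k) - ∑' k, offset lam k (d k)| := by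
  cases he : e n <;> cases hd : d n <;> simp only [he, hd, ne_eq, not_true_eq_false] at hne
  · rw [abs_sub_comm]
    exact (gap_mul_side_le_tsum_sub hL h (fun k hk => (hed k hk).symm) hd he).trans (le_abs_self _)
  · exact (gap_mul_side_le_tsum_sub hL h hed he hd).trans (le_abs_self _)

theorem norm_point_sub_le (hL : L < 1 / 2) (h : ∀ n, 1 ≤ n → 1 / 4 ≤ lam n ∧ lam n ≤ L)
    {w v : ℕ → Bool × Bool} {n : ℕ} (hwv : ∀ k < n, w k = v k) :
    ‖point lam w - point lam v‖ ≤ 2 * side lam n := by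
  refine (Complex.norm_le_abs_re_add_abs_im _).trans ?_
  have h1 := abs_tsum_sub_le hL h (e := fun k => (w k).1) (d := fun k => (v k).1) (n := n)
    fun k hk => by rw [hwv k hk]
  have h2 := abs_tsum_sub_le hL h (e := fun k => (w k).2) (d := fun k => (v k).2) (n := n)
    fun k hk => by rw [hwv k hk]
  rw [Complex.sub_re, Complex.sub_im]
  simp only [point]
  linarith

/-- The gap is taken at the first letter where the words differ; its generation is at most `n`, so
its side is at least `side lam n`. -/
theorem le_norm_point_sub (hL : L < 1 / 2) (h : ∀ n, 1 ≤ n → 1 / 4 ≤ lam n ∧ lam n ≤ L)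
    {w v : ℕ → Bool × Bool} {n : ℕ} (hwv : ∃ k < n + 1, w k ≠ v k) :
    (1 - 2 * L) * side lam n ≤ ‖point lam w - point lam v‖ := by
  classical
  have hk := Nat.find_spec hwv
  have hmin : ∀ j < Nat.find hwv, w j = v j := fun j hj => by
    have := Nat.find_min hwv hj
    push Not at this
    exact this (hj.trans hk.1)
  generalize Nat.find hwv = k at hk hmin
  refine (mul_le_mul_of_nonneg_left (side_antitone hL h (show k ≤ n by omega))
    (by linarith)).trans ?_
  by_cases h1 : (w k).1 = (v k).1
  · have h2 : (w k).2 ≠ (v k).2 := fun h2 => hk.2 (Prod.ext h1 h2)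
    refine (gap_mul_side_le_abs_tsum_sub hL h (e := fun k => (w k).2) (d := fun k => (v k).2)
      (fun j hj => by rw [hmin j hj]) h2).trans ?_
    exact Complex.abs_im_le_norm (point lam w - point lam v)
  · refine (gap_mul_side_le_abs_tsum_sub hL h (e := fun k => (w k).1) (d := fun k => (v k).1)
      (fun j hj => by rw [hmin j hj]) h1).trans ?_
    exact Complex.abs_re_le_norm (point lam w - point lam v)

theorem point_mem_cantorSet (hL : L < 1 / 2) (h : ∀ n, 1 ≤ n → 1 / 4 ≤ lam n ∧ lam n ≤ L)
    (w : ℕ → Bool × Bool) : point lam w ∈ cantorSet lam :=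
  Set.mem_iInter.2 fun n => Set.mem_biUnion ⟨w, rfl⟩
    ((point_mem_square_iff hL h w w n).2 fun _ _ => rfl)

end Geometry

/-! ### Monotonicity of the density -/

section Density

variable {lam : ℕ → ℝ} {L : ℝ}

theorem density_pos (h : ∀ n, 1 ≤ n → 1 / 4 ≤ lam n ∧ lam n ≤ L) (n : ℕ) : 0 < density lam n := by
  have := side_pos h n
  unfold density
  positivity

theorem density_antitone (h : ∀ n, 1 ≤ n → 1 / 4 ≤ lam n ∧ lam n ≤ L) :
    Antitone (density lam) := by
  refine antitone_nat_of_succ_le fun n => ?_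
  have := side_pos h n
  have h1 := (h (n + 1) (by omega)).1
  unfold density
  refine one_div_le_one_div_of_le (by positivity) ?_
  rw [side_succ, pow_succ]
  have : 0 < 4 ^ n * side lam n := by positivity
  nlinarith

end Density

/-! ### Hausdorff dimension: lower bound for trees, upper bound for the Cantor set -/

section Dimension

variable {lam : ℕ → ℝ} {L : ℝ}

/-- A tree of words in which the `m` successors of a node, reached after `M` further letters, number
at least `4 ^ (r * M)` gives a set of dimension at least `r`. -/
theorem le_dimH_range_point (hL : L < 1 / 2) (h : ∀ n, 1 ≤ n → 1 / 4 ≤ lam n ∧ lam n ≤ L)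
    {M m : ℕ} {φ : (ℕ → Fin m) → ℕ → Bool × Bool} {r : ℝ} (hr : 0 < r) (hm : 1 < m)
    (hM : (4 : ℝ) ^ (r * M) ≤ m)
    (hφ : ∀ g h k, (∀ i < k, g i = h i) → g k ≠ h k → ∃ j < (k + 1) * M, φ g j ≠ φ h j) :
    ENNReal.ofReal r ≤ dimH (Set.range fun g => point lam (φ g)) := by
  have : NeZero m := ⟨by omega⟩
  have hm0 : (0 : ℝ) < m := by exact_mod_cast (by omega : 0 < m)
  have hgap : 0 < 1 - 2 * L := by linarith
  -- The tree is parametrized by $[0,1)$ through base `m` digits. The inverse of this map is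
  -- `r`-Hölder on the image, so the image has dimension at least `r` times that of $[0,1)$.
  set ψ : ℝ → ℂ := fun x => point lam (φ (Real.digits x m)) with hψ
  set I : Set ℝ := Set.Ico 0 1
  set C : ℝ := m * ((1 - 2 * L) ^ r)⁻¹ with hC
  have hC0 : 0 < C := by positivity
  have key : ∀ x ∈ I, ∀ y ∈ I, dist x y ≤ C * dist (ψ x) (ψ y) ^ r := by
    intro x hx y hy
    by_cases hxy : Real.digits x m = Real.digits y m
    · have : x = y := by
        rw [← Real.ofDigits_digits hm hx, ← Real.ofDigits_digits hm hy, hxy]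
      rw [this, dist_self]
      positivity
    · classical
      have hex : ∃ k, Real.digits x m k ≠ Real.digits y m k := by
        by_contra! H
        exact hxy (funext H)
      have hk := Nat.find_spec hex
      have hmin : ∀ j < Nat.find hex, Real.digits x m j = Real.digits y m j := fun j hj =>
        not_not.1 (Nat.find_min hex hj)
      generalize Nat.find hex = k at hk hmin
      have h1 := Real.abs_ofDigits_sub_ofDigits_le hmin
      rw [Real.ofDigits_digits hm hx, Real.ofDigits_digits hm hy] at h1
      obtain ⟨j, hj, hne⟩ := hφ _ _ k hmin hk
      -- If `k` is the first digit that differs, then $|x-y|\le m^{-k}$, while the words differ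
      -- before letter $(k+1)M$ and the points are at least a constant times $4^{-(k+1)M}$ apart.
      have h2 : (1 - 2 * L) * ((4 : ℝ) ^ ((k + 1) * M))⁻¹ ≤ dist (ψ x) (ψ y) := by
        rw [dist_eq_norm]
        refine le_trans ?_ (le_norm_point_sub hL h (n := (k + 1) * M) ⟨j, by omega, hne⟩)
        exact mul_le_mul_of_nonneg_left (pow_le_side h _) hgap.le
      have h3 := Real.rpow_le_rpow (by positivity) h2 hr.le
      rw [Real.mul_rpow hgap.le (by positivity), Real.inv_rpow (by positivity)] at h3
      have h4 : ((4 : ℝ) ^ ((k + 1) * M)) ^ r ≤ (m : ℝ) ^ (k + 1) := by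
        calc ((4 : ℝ) ^ ((k + 1) * M)) ^ r = ((4 : ℝ) ^ (r * M)) ^ (k + 1) := by
              rw [← Real.rpow_natCast, ← Real.rpow_mul (by norm_num), ← Real.rpow_natCast,
                ← Real.rpow_mul (by norm_num)]
              congr 1
              push_cast
              ring
          _ ≤ _ := pow_le_pow_left₀ (by positivity) hM _
      have h5 : ((m : ℝ) ^ (k + 1))⁻¹ ≤ (((4 : ℝ) ^ ((k + 1) * M)) ^ r)⁻¹ :=
        inv_anti₀ (by positivity) h4
      calc dist x y = |x - y| := Real.dist_eq _ _
        _ ≤ ((m : ℝ) ^ k)⁻¹ := h1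
        _ = C * ((1 - 2 * L) ^ r * ((m : ℝ) ^ (k + 1))⁻¹) := by
            rw [hC, pow_succ]
            have : (1 - 2 * L) ^ r ≠ 0 := by positivity
            field_simp
        _ ≤ C * dist (ψ x) (ψ y) ^ r := by
            refine mul_le_mul_of_nonneg_left (le_trans ?_ h3) hC0.le
            exact mul_le_mul_of_nonneg_left h5 (by positivity)
  have hinj : Set.InjOn ψ I := fun x hx y hy hxy => by
    have := key x hx y hy
    rw [hxy, dist_self, Real.zero_rpow hr.ne', mul_zero] at this
    exact dist_le_zero.1 this
  set f : ℂ → ℝ := Function.invFunOn ψ I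
  have hf : ∀ x ∈ I, f (ψ x) = x := fun x hx => hinj.leftInvOn_invFunOn hx
  have hhol : HolderOnWith C.toNNReal r.toNNReal f (ψ '' I) := by
    rintro _ ⟨x, hx, rfl⟩ _ ⟨y, hy, rfl⟩
    rw [hf x hx, hf y hy, Real.coe_toNNReal _ hr.le, edist_dist, edist_dist,
      ENNReal.ofReal_rpow_of_nonneg dist_nonneg hr.le]
    change _ ≤ ENNReal.ofReal C * _
    rw [← ENNReal.ofReal_mul hC0.le]
    exact ENNReal.ofReal_le_ofReal (key x hx y hy)
  have hr' : 0 < r.toNNReal := Real.toNNReal_pos.2 hr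
  have hdim := hhol.dimH_image_le hr'
  have himage : f '' (ψ '' I) = I := by
    rw [Set.image_image]
    exact (Set.image_congr hf).trans (Set.image_id' I)
  have hI : dimH I = 1 := by
    rw [Real.dimH_of_nonempty_interior (by simp [I, interior_Ico])]
    simp
  rw [himage, hI, ENNReal.le_div_iff_mul_le (by simp [hr]) (by simp), one_mul] at hdim
  refine le_trans hdim (dimH_mono ?_)
  rintro _ ⟨x, -, rfl⟩
  exact ⟨_, rfl⟩

/-- The full tree, `M = 1` and `m = 4`, satisfies the entropy condition with `r = 1`. -/
theorem one_le_dimH_range_point (hL : L < 1 / 2) (h : ∀ n, 1 ≤ n → 1 / 4 ≤ lam n ∧ lam n ≤ L) :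
    1 ≤ dimH (Set.range (point lam)) := by
  let e : Fin 4 ≃ Bool × Bool := Fintype.equivOfCardEq (by simp)
  have := le_dimH_range_point hL h (M := 1) (φ := fun g k => e (g k)) one_pos (by norm_num : 1 < 4)
    (by norm_num) fun g h k _ hk => ⟨k, by omega, fun H => hk (e.injective H)⟩
  rw [ENNReal.ofReal_one] at this
  refine this.trans (dimH_mono ?_)
  rintro _ ⟨g, rfl⟩
  exact ⟨_, rfl⟩

theorem ediam_square_le (c : ℂ) (s : ℝ) : Metric.ediam (square c s) ≤ ENNReal.ofReal (2 * s) := by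
  refine Metric.ediam_le_of_forall_dist_le fun x hx y hy => ?_
  obtain ⟨hx1, hx2⟩ := Complex.mem_reProdIm.1 hx
  obtain ⟨hy1, hy2⟩ := Complex.mem_reProdIm.1 hy
  rw [dist_eq_norm]
  refine (Complex.norm_le_abs_re_add_abs_im _).trans ?_
  have h1 := abs_sub_le_of_le_of_le hx1.1 hx1.2 hy1.1 hy1.2
  have h2 := abs_sub_le_of_le_of_le hx2.1 hx2.2 hy2.1 hy2.2
  rw [Complex.sub_re, Complex.sub_im]
  linarith

theorem cantorSet_subset_iUnion (lam : ℕ → ℝ) (n : ℕ) :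
    cantorSet lam ⊆ ⋃ u : Fin n → Bool × Bool,
      square (corner lam n (splice 0 (fun _ => (true, true)) u (true, true))) (side lam n) := by
  intro x hx
  obtain ⟨_, ⟨w, rfl⟩, hxw⟩ := Set.mem_iUnion₂.1 (Set.mem_iInter.1 hx n)
  refine Set.mem_iUnion.2 ⟨fun k => w k, ?_⟩
  convert hxw using 2
  have : ∀ k < n, splice 0 (fun _ => (true, true)) (fun k : Fin n => w k) (true, true) k = w k := by
    intro k hk
    simp [splice, hk]
  unfold corner
  congr 1 <;>
  exact Finset.sum_congr rfl fun k hk => by rw [this k (Finset.mem_range.1 hk)]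

/-- This is the `d`-dimensional cost of covering by $4^n$ squares of side $n4^{-n}$; it equals
$2^dn^d4^{-(d-1)n}$. -/
theorem tendsto_pow_mul_rpow {d : ℝ} (hd : 1 < d) :
    Tendsto (fun n : ℕ => (4 : ℝ) ^ n * (2 * (n * ((4 : ℝ) ^ n)⁻¹)) ^ d) atTop (𝓝 0) := by
  have hb : 0 < (d - 1) * Real.log 4 := mul_pos (by linarith) (Real.log_pos (by norm_num))
  have h1 := ((tendsto_rpow_mul_exp_neg_mul_atTop_nhds_zero d _ hb).comp
    tendsto_natCast_atTop_atTop).const_mul ((2 : ℝ) ^ d)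
  rw [mul_zero] at h1
  refine h1.congr fun n => ?_
  have h4 : (4 : ℝ) ^ n = Real.exp (Real.log 4 * n) := by
    rw [← Real.rpow_natCast, Real.rpow_def_of_pos (by norm_num)]
  rw [Real.mul_rpow (by norm_num) (by positivity), Real.mul_rpow (by positivity) (by positivity),
    h4, ← Real.exp_neg, ← Real.exp_mul, Function.comp]
  have : Real.exp (-((d - 1) * Real.log 4) * n) =
      Real.exp (Real.log 4 * n) * Real.exp (-(Real.log 4 * n) * d) := by
    rw [← Real.exp_add]
    congr 1
    ring
  rw [this]
  ring

theorem frequently_inv_le_of_not_summable_sq {a : ℕ → ℝ} (ha : ∀ n, 0 ≤ a n)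
    (hs : ¬ Summable fun n => a n ^ 2) : ∃ᶠ n : ℕ in atTop, (n : ℝ)⁻¹ ≤ a n := by
  intro H
  refine hs (Summable.of_norm_bounded_eventually_nat (Real.summable_nat_pow_inv.2 one_lt_two) ?_)
  filter_upwards [H] with n hn
  rw [Real.norm_of_nonneg (sq_nonneg _), ← inv_pow]
  exact pow_le_pow_left₀ (ha n) (not_le.1 hn).le 2

theorem dimH_cantorSet_le_one (hL : L < 1 / 2) (h : ∀ n, 1 ≤ n → 1 / 4 ≤ lam n ∧ lam n ≤ L)
    (hs : ¬ Summable fun n => density lam n ^ 2) : dimH (cantorSet lam) ≤ 1 := by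
  refine dimH_le fun d hd => ?_
  by_contra! hd1
  have hd1' : (1 : ℝ) < d := by exact_mod_cast hd1
  have hfreq := frequently_inv_le_of_not_summable_sq (a := density lam) (fun n => (density_pos h n).le) hs
  -- Only the generations with $a_n\ge1/n$ are used as covers; there are infinitely many, so `l` is
  -- a proper filter.
  set l : Filter ℕ := atTop ⊓ 𝓟 {n : ℕ | (n : ℝ)⁻¹ ≤ density lam n}
  have : l.NeBot := frequently_mem_iff_neBot.1 hfreq
  have hside : ∀ᶠ n in l, side lam n ≤ n * ((4 : ℝ) ^ n)⁻¹ := by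
    have h1 : ∀ᶠ n in l, 1 ≤ n := (eventually_ge_atTop 1).filter_mono inf_le_left
    have h2 : ∀ᶠ n : ℕ in l, (n : ℝ)⁻¹ ≤ density lam n := mem_inf_of_right (mem_principal_self _)
    filter_upwards [h1, h2] with n hn hn2
    have hn0 : (0 : ℝ) < n := by exact_mod_cast hn
    have hsp := side_pos h n
    rw [density, one_div, inv_le_inv₀ hn0 (by positivity)] at hn2
    rw [← div_eq_mul_inv, le_div_iff₀ (by positivity)]
    linarith
  have hdiam : Tendsto (fun n => ENNReal.ofReal (2 * side lam n)) l (𝓝 0) := by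
    have := ENNReal.tendsto_ofReal ((side_tendsto hL h).const_mul 2)
    rw [mul_zero, ENNReal.ofReal_zero] at this
    exact this.mono_left inf_le_left
  have hle := Measure.hausdorffMeasure_le_liminf_sum (d : ℝ) (cantorSet lam) (l := l) _ hdiam
    (fun n (u : Fin n → Bool × Bool) =>
      square (corner lam n (splice 0 (fun _ => (true, true)) u (true, true))) (side lam n))
    (Eventually.of_forall fun n u => ediam_square_le _ _)
    (Eventually.of_forall fun n => cantorSet_subset_iUnion lam n)
  have hlim : Tendsto (fun n => ∑ u : Fin n → Bool × Bool, Metric.ediam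
      (square (corner lam n (splice 0 (fun _ => (true, true)) u (true, true))) (side lam n)) ^ (d : ℝ))
      l (𝓝 0) := by
    have h0 := ENNReal.tendsto_ofReal ((tendsto_pow_mul_rpow hd1').mono_left
      (inf_le_left : l ≤ atTop))
    rw [ENNReal.ofReal_zero] at h0
    refine tendsto_of_tendsto_of_tendsto_of_le_of_le' tendsto_const_nhds h0
      (Eventually.of_forall fun _ => zero_le) ?_
    filter_upwards [hside] with n hn
    have hsp := side_pos h n
    calc _ ≤ ∑ u : Fin n → Bool × Bool, ENNReal.ofReal ((2 * (n * ((4 : ℝ) ^ n)⁻¹)) ^ (d : ℝ)) := by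
          refine Finset.sum_le_sum fun u _ => ?_
          rw [← ENNReal.ofReal_rpow_of_nonneg (by positivity) (by positivity)]
          refine ENNReal.rpow_le_rpow ((ediam_square_le _ _).trans ?_) (by positivity)
          exact ENNReal.ofReal_le_ofReal (by linarith)
      _ = _ := by
          rw [ENNReal.ofReal_mul (by positivity), ENNReal.ofReal_pow (by norm_num)]
          simp
  rw [hlim.liminf_eq, hd] at hle
  simp at hle

end Dimension


/-! ### Transfer from points to words -/

/-- The law of a sequence of independent letters, uniform over the four corners. -/
def wordMeasure : Measure (ℕ → Bool × Bool) :=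
  Measure.infinitePi fun _ : ℕ => (PMF.uniformOfFintype (Bool × Bool)).toMeasure

instance : IsProbabilityMeasure wordMeasure := by
  unfold wordMeasure
  infer_instance

/-- The words that agree with `w` up to the letter `n`. -/
def cyl (n : ℕ) (w : ℕ → Bool × Bool) : Set (ℕ → Bool × Bool) := {v | ∀ k < n, v k = w k}

theorem mem_cyl_comm {n : ℕ} {v w : ℕ → Bool × Bool} : v ∈ cyl n w ↔ w ∈ cyl n v :=
  forall₂_congr fun _ _ => eq_comm

theorem cyl_eq {n : ℕ} {v w : ℕ → Bool × Bool} (h : v ∈ cyl n w) : cyl n v = cyl n w := by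
  ext u
  exact forall₂_congr fun k hk => by rw [h k hk]

theorem cyl_succ_subset (n : ℕ) (w : ℕ → Bool × Bool) : cyl (n + 1) w ⊆ cyl n w :=
  fun _ hv k hk => hv k (by omega)

theorem mem_cyl_self (n : ℕ) (w : ℕ → Bool × Bool) : w ∈ cyl n w := fun _ _ => rfl

theorem cyl_eq_pi (n : ℕ) (w : ℕ → Bool × Bool) :
    cyl n w = Set.pi (Finset.range n : Set ℕ) fun k => {w k} := by
  ext v
  simp [cyl]

theorem measurableSet_cyl (n : ℕ) (w : ℕ → Bool × Bool) : MeasurableSet (cyl n w) := by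
  rw [cyl_eq_pi]
  exact MeasurableSet.pi (Set.to_countable _) fun _ _ => measurableSet_singleton _

theorem measurableSet_setOf_mem_cyl (n : ℕ) :
    MeasurableSet {p : (ℕ → Bool × Bool) × (ℕ → Bool × Bool) | p.2 ∈ cyl n p.1} := by
  have : {p : (ℕ → Bool × Bool) × (ℕ → Bool × Bool) | p.2 ∈ cyl n p.1} =
      ⋂ k, ⋂ _ : k < n, {p | p.2 k = p.1 k} := by
    ext p
    simp [cyl]
  rw [this]
  exact MeasurableSet.iInter fun k => MeasurableSet.iInter fun _ =>
    measurableSet_eq_fun (by fun_prop) (by fun_prop)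

theorem wordMeasure_cyl (n : ℕ) (w : ℕ → Bool × Bool) :
    wordMeasure (cyl n w) = ((4 : ENNReal) ^ n)⁻¹ := by
  rw [cyl_eq_pi, wordMeasure, Measure.infinitePi_pi _ (fun _ _ => measurableSet_singleton _)]
  simp [PMF.uniformOfFintype_apply, ENNReal.inv_pow]

theorem wordMeasure_real_cyl (n : ℕ) (w : ℕ → Bool × Bool) :
    wordMeasure.real (cyl n w) = ((4 : ℝ) ^ n)⁻¹ := by
  simp [measureReal_def, wordMeasure_cyl]

open Classical in
/-- The Cauchy kernel at the points coded by `v` and `u`, truncated at generation `n`. -/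
def truncKernel (lam : ℕ → ℝ) (n : ℕ) (v u : ℕ → Bool × Bool) : ℂ :=
  if u ∈ cyl n v then 0 else 1 / (point lam v - point lam u)

/-- The truncated Cauchy integral as a function of the word. -/
def wordCauchy (lam : ℕ → ℝ) (n : ℕ) (v : ℕ → Bool × Bool) : ℂ :=
  ∫ u, truncKernel lam n v u ∂wordMeasure

/-- The averages of the truncated Cauchy integral as a function of the word. -/
def wordMart (lam : ℕ → ℝ) (n : ℕ) (w : ℕ → Bool × Bool) : ℂ :=
  4 ^ n * ∫ v in cyl n w, wordCauchy lam n v ∂wordMeasure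

section Transfer

variable {lam : ℕ → ℝ} {L : ℝ}

theorem point_injective (hL : L < 1 / 2) (h : ∀ n, 1 ≤ n → 1 / 4 ≤ lam n ∧ lam n ≤ L) :
    Function.Injective (point lam) := fun w v hwv => funext fun k => by
  have := (point_mem_square_iff hL h w w (k + 1)).2 fun _ _ => rfl
  rw [hwv, point_mem_square_iff hL h] at this
  exact (this k (by omega)).symm

theorem measurableEmbedding_point (hL : L < 1 / 2)
    (h : ∀ n, 1 ≤ n → 1 / 4 ≤ lam n ∧ lam n ≤ L) : MeasurableEmbedding (point lam) :=
  (measurable_point hL h).measurableEmbedding (point_injective hL h)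

/-- Squares of one generation that contain the point share their first `n` letters, so the union in
`squareAt` has a single member. -/
theorem squareAt_point (hL : L < 1 / 2) (h : ∀ n, 1 ≤ n → 1 / 4 ≤ lam n ∧ lam n ≤ L) (n : ℕ)
    (w : ℕ → Bool × Bool) :
    squareAt lam n (point lam w) = square (corner lam n w) (side lam n) := by
  have hcorner : ∀ v, (∀ k < n, w k = v k) → corner lam n v = corner lam n w := by
    intro v hv
    unfold corner
    congr 1 <;>
    exact Finset.sum_congr rfl fun k hk => by rw [hv k (Finset.mem_range.1 hk)]
  refine Set.Subset.antisymm (Set.sUnion_subset ?_) (Set.subset_sUnion_of_mem ⟨⟨w, rfl⟩, ?_⟩)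
  · rintro _ ⟨⟨v, rfl⟩, hv⟩
    rw [hcorner v ((point_mem_square_iff hL h w v n).1 hv)]
  · exact (point_mem_square_iff hL h w w n).2 fun _ _ => rfl

theorem preimage_squareAt (hL : L < 1 / 2) (h : ∀ n, 1 ≤ n → 1 / 4 ≤ lam n ∧ lam n ≤ L) (n : ℕ)
    (w : ℕ → Bool × Bool) : point lam ⁻¹' squareAt lam n (point lam w) = cyl n w := by
  ext v
  rw [squareAt_point hL h, Set.mem_preimage, point_mem_square_iff hL h]
  rfl

theorem truncCauchy_point (hL : L < 1 / 2) (h : ∀ n, 1 ≤ n → 1 / 4 ≤ lam n ∧ lam n ≤ L) (n : ℕ)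
    (v : ℕ → Bool × Bool) : truncCauchy lam n (point lam v) = wordCauchy lam n v := by
  have hpre : point lam ⁻¹' (cantorSet lam \ squareAt lam n (point lam v)) = (cyl n v)ᶜ := by
    rw [Set.preimage_sdiff, preimage_squareAt hL h,
      Set.eq_univ_of_forall (s := point lam ⁻¹' cantorSet lam) (point_mem_cantorSet hL h),
      Set.compl_eq_univ_sdiff]
  rw [truncCauchy, cantorMeasure, (measurableEmbedding_point hL h).setIntegral_map, hpre,
    wordCauchy, ← integral_indicator (measurableSet_cyl n v).compl]
  refine integral_congr_ae (Eventually.of_forall fun u => ?_)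
  by_cases hu : u ∈ cyl n v <;> simp [truncKernel, hu]

theorem mart_point (hL : L < 1 / 2) (h : ∀ n, 1 ≤ n → 1 / 4 ≤ lam n ∧ lam n ≤ L) (n : ℕ)
    (w : ℕ → Bool × Bool) : mart lam n (point lam w) = wordMart lam n w := by
  have hμ : (cantorMeasure lam).real (squareAt lam n (point lam w)) = ((4 : ℝ) ^ n)⁻¹ := by
    rw [squareAt_point hL h, measureReal_def, (cantorMeasure_spec hL h).2.2 n _ ⟨w, rfl⟩]
    simp
  rw [mart, setAverage_eq, hμ, cantorMeasure, (measurableEmbedding_point hL h).setIntegral_map,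
    preimage_squareAt hL h, wordMart, inv_inv, Complex.real_smul]
  push_cast
  congr 1
  exact setIntegral_congr_fun (measurableSet_cyl n w) fun v _ => truncCauchy_point hL h n v

end Transfer

/-! ### Martingale property and size estimates -/

section Kernel

variable {lam : ℕ → ℝ} {L : ℝ}

theorem norm_inv_point_sub_le (hL : L < 1 / 2) (h : ∀ n, 1 ≤ n → 1 / 4 ≤ lam n ∧ lam n ≤ L)
    {n : ℕ} {v u : ℕ → Bool × Bool} (huv : u ∉ cyl (n + 1) v) :
    ‖1 / (point lam v - point lam u)‖ ≤ ((1 - 2 * L) * side lam n)⁻¹ := by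
  have hp : 0 < (1 - 2 * L) * side lam n := mul_pos (by linarith) (side_pos h n)
  rw [norm_div, norm_one, one_div]
  refine inv_anti₀ hp (le_norm_point_sub hL h ?_)
  simpa [cyl, eq_comm] using huv

theorem measurable_truncKernel (hL : L < 1 / 2) (h : ∀ n, 1 ≤ n → 1 / 4 ≤ lam n ∧ lam n ≤ L)
    (n : ℕ) : Measurable fun p : (ℕ → Bool × Bool) × (ℕ → Bool × Bool) =>
      truncKernel lam n p.1 p.2 := by
  have hp := measurable_point hL h
  refine Measurable.ite (measurableSet_setOf_mem_cyl n) measurable_const ?_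
  exact measurable_const.div ((hp.comp measurable_fst).sub (hp.comp measurable_snd))

theorem norm_truncKernel_le (hL : L < 1 / 2) (h : ∀ n, 1 ≤ n → 1 / 4 ≤ lam n ∧ lam n ≤ L)
    (n : ℕ) (v u : ℕ → Bool × Bool) :
    ‖truncKernel lam n v u‖ ≤ ((1 - 2 * L) * side lam n)⁻¹ := by
  have hp : 0 < (1 - 2 * L) * side lam n := mul_pos (by linarith) (side_pos h n)
  unfold truncKernel
  split_ifs with huv
  · rw [norm_zero]
    positivity
  · exact norm_inv_point_sub_le hL h fun H => huv (cyl_succ_subset n v H)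

theorem integrable_truncKernel (hL : L < 1 / 2) (h : ∀ n, 1 ≤ n → 1 / 4 ≤ lam n ∧ lam n ≤ L)
    (n : ℕ) (v : ℕ → Bool × Bool) : Integrable (truncKernel lam n v) wordMeasure :=
  Integrable.of_bound
    ((measurable_truncKernel hL h n).comp measurable_prodMk_left).aestronglyMeasurable _
    (Eventually.of_forall fun u => norm_truncKernel_le hL h n v u)

theorem integrable_wordCauchy (hL : L < 1 / 2) (h : ∀ n, 1 ≤ n → 1 / 4 ≤ lam n ∧ lam n ≤ L)
    (n : ℕ) : Integrable (wordCauchy lam n) wordMeasure := by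
  refine Integrable.of_bound
    (measurable_truncKernel hL h n).stronglyMeasurable.integral_prod_right.aestronglyMeasurable
    ((1 - 2 * L) * side lam n)⁻¹ (Eventually.of_forall fun v => ?_)
  refine (norm_integral_le_of_norm_le_const
    (Eventually.of_forall fun u => norm_truncKernel_le hL h n v u)).trans ?_
  simp

/-- The part of the Cauchy kernel that the passage from generation `n` to `n + 1` adds. -/
def kernelStep (lam : ℕ → ℝ) (n : ℕ) (v u : ℕ → Bool × Bool) : ℂ :=
  truncKernel lam (n + 1) v u - truncKernel lam n v u

theorem kernelStep_of_mem {n : ℕ} {v u : ℕ → Bool × Bool} (h1 : u ∈ cyl n v)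
    (h2 : u ∉ cyl (n + 1) v) : kernelStep lam n v u = 1 / (point lam v - point lam u) := by
  simp [kernelStep, truncKernel, h1, h2]

theorem kernelStep_of_mem_succ {n : ℕ} {v u : ℕ → Bool × Bool} (h : u ∈ cyl (n + 1) v) :
    kernelStep lam n v u = 0 := by
  simp [kernelStep, truncKernel, h, cyl_succ_subset n v h]

theorem kernelStep_of_notMem {n : ℕ} {v u : ℕ → Bool × Bool} (h : u ∉ cyl n v) :
    kernelStep lam n v u = 0 := by
  have h2 : u ∉ cyl (n + 1) v := fun H => h (cyl_succ_subset n v H)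
  simp [kernelStep, truncKernel, h, h2]

theorem kernelStep_swap (lam : ℕ → ℝ) (n : ℕ) (v u : ℕ → Bool × Bool) :
    kernelStep lam n u v = -kernelStep lam n v u := by
  by_cases h1 : u ∈ cyl n v
  · by_cases h2 : u ∈ cyl (n + 1) v
    · rw [kernelStep_of_mem_succ h2, kernelStep_of_mem_succ (mem_cyl_comm.1 h2), neg_zero]
    · rw [kernelStep_of_mem h1 h2,
        kernelStep_of_mem (mem_cyl_comm.1 h1) fun H => h2 (mem_cyl_comm.1 H),
        ← neg_sub (point lam v), div_neg]
  · rw [kernelStep_of_notMem h1, kernelStep_of_notMem fun H => h1 (mem_cyl_comm.1 H), neg_zero]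

theorem integral_kernelStep (hL : L < 1 / 2) (h : ∀ n, 1 ≤ n → 1 / 4 ≤ lam n ∧ lam n ≤ L)
    (n : ℕ) (v : ℕ → Bool × Bool) :
    ∫ u, kernelStep lam n v u ∂wordMeasure = wordCauchy lam (n + 1) v - wordCauchy lam n v :=
  integral_sub (integrable_truncKernel hL h (n + 1) v) (integrable_truncKernel hL h n v)

theorem integral_kernelStep_eq_setIntegral (lam : ℕ → ℝ) (n : ℕ) (v : ℕ → Bool × Bool) :
    ∫ u, kernelStep lam n v u ∂wordMeasure = ∫ u in cyl n v, kernelStep lam n v u ∂wordMeasure :=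
  (setIntegral_eq_integral_of_forall_compl_eq_zero fun _ hu => kernelStep_of_notMem hu).symm

theorem norm_kernelStep_le (hL : L < 1 / 2) (h : ∀ n, 1 ≤ n → 1 / 4 ≤ lam n ∧ lam n ≤ L)
    (n : ℕ) (v u : ℕ → Bool × Bool) :
    ‖kernelStep lam n v u‖ ≤ ((1 - 2 * L) * side lam n)⁻¹ := by
  have hp : 0 < (1 - 2 * L) * side lam n := mul_pos (by linarith) (side_pos h n)
  by_cases h1 : u ∈ cyl n v
  · by_cases h2 : u ∈ cyl (n + 1) v
    · rw [kernelStep_of_mem_succ h2, norm_zero]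
      positivity
    · rw [kernelStep_of_mem h1 h2]
      exact norm_inv_point_sub_le hL h h2
  · rw [kernelStep_of_notMem h1, norm_zero]
    positivity

/-- The added kernel lives on a cylinder of mass $4^{-n}$ and is at most $((1-2L)s_n)^{-1}$ there.
-/
theorem norm_wordCauchy_succ_sub_le (hL : L < 1 / 2)
    (h : ∀ n, 1 ≤ n → 1 / 4 ≤ lam n ∧ lam n ≤ L) (n : ℕ) (v : ℕ → Bool × Bool) :
    ‖wordCauchy lam (n + 1) v - wordCauchy lam n v‖ ≤ (1 - 2 * L)⁻¹ * density lam n := by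
  rw [← integral_kernelStep hL h, integral_kernelStep_eq_setIntegral]
  refine (norm_setIntegral_le_of_norm_le_const (measure_lt_top _ _)
    fun u _ => norm_kernelStep_le hL h n v u).trans (le_of_eq ?_)
  rw [wordMeasure_real_cyl, density, one_div, mul_inv, mul_inv]
  ring

/-- The difference is the double integral of an antisymmetric kernel over `cyl n w` squared, hence
equal to its own negative by Fubini. -/
theorem setIntegral_wordCauchy_succ (hL : L < 1 / 2)
    (h : ∀ n, 1 ≤ n → 1 / 4 ≤ lam n ∧ lam n ≤ L) (n : ℕ) (w : ℕ → Bool × Bool) :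
    ∫ v in cyl n w, wordCauchy lam (n + 1) v ∂wordMeasure =
      ∫ v in cyl n w, wordCauchy lam n v ∂wordMeasure := by
  rw [← sub_eq_zero, ← integral_sub (integrable_wordCauchy hL h _).integrableOn
    (integrable_wordCauchy hL h _).integrableOn]
  have h1 : ∫ v in cyl n w, (wordCauchy lam (n + 1) v - wordCauchy lam n v) ∂wordMeasure =
      ∫ v in cyl n w, ∫ u in cyl n w, kernelStep lam n v u ∂wordMeasure ∂wordMeasure := by
    refine setIntegral_congr_fun (measurableSet_cyl n w) fun v hv => ?_
    rw [← integral_kernelStep hL h, integral_kernelStep_eq_setIntegral, cyl_eq hv]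
  have hint : Integrable (Function.uncurry fun v u => kernelStep lam n v u)
      ((wordMeasure.restrict (cyl n w)).prod (wordMeasure.restrict (cyl n w))) :=
    Integrable.of_bound
      ((measurable_truncKernel hL h (n + 1)).sub
        (measurable_truncKernel hL h n)).aestronglyMeasurable _
      (Eventually.of_forall fun p => norm_kernelStep_le hL h n p.1 p.2)
  have h2 : ∫ u in cyl n w, ∫ v in cyl n w, kernelStep lam n v u ∂wordMeasure ∂wordMeasure =
      -∫ v in cyl n w, ∫ u in cyl n w, kernelStep lam n v u ∂wordMeasure ∂wordMeasure := by
    rw [← integral_neg]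
    refine integral_congr_ae (Eventually.of_forall fun u => ?_)
    simp only
    rw [← integral_neg]
    exact integral_congr_ae (Eventually.of_forall fun v => kernelStep_swap lam n u v)
  rw [h1]
  exact self_eq_neg.1 ((integral_integral_swap hint).trans h2)

theorem cyl_eq_iUnion_update (n : ℕ) (w : ℕ → Bool × Bool) :
    cyl n w = ⋃ b : Bool × Bool, cyl (n + 1) (Function.update w n b) := by
  ext v
  rw [Set.mem_iUnion]
  constructor
  · intro hv
    refine ⟨v n, fun k hk => ?_⟩
    rcases Nat.lt_succ_iff_lt_or_eq.1 hk with hk | rfl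
    · rw [Function.update_of_ne hk.ne, hv k hk]
    · rw [Function.update_self]
  · rintro ⟨b, hv⟩ k hk
    rw [hv k (by omega), Function.update_of_ne hk.ne]

theorem sum_wordMart_update (hL : L < 1 / 2) (h : ∀ n, 1 ≤ n → 1 / 4 ≤ lam n ∧ lam n ≤ L)
    (n : ℕ) (w : ℕ → Bool × Bool) :
    ∑ b, wordMart lam (n + 1) (Function.update w n b) = 4 * wordMart lam n w := by
  unfold wordMart
  rw [← Finset.mul_sum, ← setIntegral_wordCauchy_succ hL h, cyl_eq_iUnion_update,
    integral_iUnion_fintype (fun b => measurableSet_cyl _ _) ?_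
      (fun b => (integrable_wordCauchy hL h _).integrableOn)]
  · ring
  · intro b b' hb
    refine Set.disjoint_left.2 fun v hv hv' => hb ?_
    have h1 := hv n (by omega)
    have h2 := hv' n (by omega)
    rw [Function.update_self] at h1 h2
    rw [← h1, h2]

/-- The Lipschitz constant, up to the factor `1 / (4 ^ n * s_n ^ 2)`, of the Cauchy integral
truncated at generation `n` on a square of that generation. -/
def lipConst (L : ℝ) : ℝ := ((1 - 4 * L ^ 2) * (1 - 2 * L) ^ 2)⁻¹

theorem lipConst_pos (hL0 : 0 ≤ L) (hL : L < 1 / 2) : 0 < lipConst L := by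
  have h1 : 0 < 1 - 4 * L ^ 2 := by nlinarith
  have h2 : 0 < 1 - 2 * L := by linarith
  unfold lipConst
  positivity

theorem norm_kernelStep_sub_le (hL : L < 1 / 2) (h : ∀ n, 1 ≤ n → 1 / 4 ≤ lam n ∧ lam n ≤ L)
    {n : ℕ} {v w : ℕ → Bool × Bool} (hvw : v ∈ cyl (n + 1) w) (u : ℕ → Bool × Bool) :
    ‖kernelStep lam n v u - kernelStep lam n w u‖ ≤
      ((1 - 2 * L) * side lam n)⁻¹ ^ 2 * ‖point lam v - point lam w‖ := by
  have hp : 0 < (1 - 2 * L) * side lam n := mul_pos (by linarith) (side_pos h n)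
  have e1 : cyl (n + 1) v = cyl (n + 1) w := cyl_eq hvw
  have e0 : cyl n v = cyl n w := cyl_eq (cyl_succ_subset n w hvw)
  by_cases h1 : u ∈ cyl n w
  · by_cases h2 : u ∈ cyl (n + 1) w
    · rw [kernelStep_of_mem_succ h2, kernelStep_of_mem_succ (e1 ▸ h2), sub_zero, norm_zero]
      positivity
    · have h2' : u ∉ cyl (n + 1) v := e1 ▸ h2
      rw [kernelStep_of_mem h1 h2, kernelStep_of_mem (e0 ▸ h1) h2']
      have k1 := norm_inv_point_sub_le hL h h2
      have k2 := norm_inv_point_sub_le hL h h2'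
      have hv0 : point lam v - point lam u ≠ 0 := sub_ne_zero.2 fun H =>
        h2' (by rw [point_injective hL h H]; exact mem_cyl_self _ _)
      have hw0 : point lam w - point lam u ≠ 0 := sub_ne_zero.2 fun H =>
        h2 (by rw [point_injective hL h H]; exact mem_cyl_self _ _)
      have : 1 / (point lam v - point lam u) - 1 / (point lam w - point lam u) =
          -(1 / (point lam v - point lam u) * (1 / (point lam w - point lam u)) *
            (point lam v - point lam w)) := by
        field_simp
        ring
      rw [this, norm_neg, norm_mul, norm_mul, sq]
      exact mul_le_mul_of_nonneg_right
        (mul_le_mul k2 k1 (norm_nonneg _) (by positivity)) (norm_nonneg _)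
  · rw [kernelStep_of_notMem h1, kernelStep_of_notMem (e0 ▸ h1), sub_zero, norm_zero]
    positivity

/-- Generation `n` adds a Lipschitz constant of at most $(1-2L)^{-2}(4^ns_n^2)^{-1}$. From one
generation to the next $(4^ns_n^2)^{-1}$ grows by a factor at least $1/(4L^2)>1$, so the
contributions add up like a geometric series dominated by its last term. -/
theorem norm_wordCauchy_sub_le_mul (hL : L < 1 / 2) (h : ∀ n, 1 ≤ n → 1 / 4 ≤ lam n ∧ lam n ≤ L)
    {n : ℕ} {v w : ℕ → Bool × Bool} (hvw : v ∈ cyl n w) :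
    ‖wordCauchy lam n v - wordCauchy lam n w‖ ≤
      lipConst L * (4 ^ n * side lam n ^ 2)⁻¹ * ‖point lam v - point lam w‖ := by
  have hL0 : 0 ≤ L := by linarith [(h 1 le_rfl).1, (h 1 le_rfl).2]
  have hl := lipConst_pos hL0 hL
  have hg : 0 < 1 - 2 * L := by linarith
  induction n with
  | zero =>
    have : ∀ v, wordCauchy lam 0 v = 0 := fun v => by simp [wordCauchy, truncKernel, cyl]
    rw [this, this, sub_zero, norm_zero]
    have := side_pos h 0
    positivity
  | succ n ih =>
    have ih' := ih (cyl_succ_subset n w hvw)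
    have hs := side_pos h n
    have e0 : cyl n v = cyl n w := cyl_eq (cyl_succ_subset n w hvw)
    have hstep : ‖(wordCauchy lam (n + 1) v - wordCauchy lam n v) -
        (wordCauchy lam (n + 1) w - wordCauchy lam n w)‖ ≤
        ((1 - 2 * L) * side lam n)⁻¹ ^ 2 * ‖point lam v - point lam w‖ * (4 ^ n : ℝ)⁻¹ := by
      have hi : ∀ v, Integrable (kernelStep lam n v) wordMeasure := fun v =>
        (integrable_truncKernel hL h (n + 1) v).sub (integrable_truncKernel hL h n v)
      rw [← integral_kernelStep hL h, ← integral_kernelStep hL h,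
        integral_kernelStep_eq_setIntegral, integral_kernelStep_eq_setIntegral, e0,
        ← integral_sub (hi v).integrableOn (hi w).integrableOn, ← wordMeasure_real_cyl n w]
      exact norm_setIntegral_le_of_norm_le_const (measure_lt_top _ _)
        fun u _ => norm_kernelStep_sub_le hL h hvw u
    have htri : ‖wordCauchy lam (n + 1) v - wordCauchy lam (n + 1) w‖ ≤
        ‖(wordCauchy lam (n + 1) v - wordCauchy lam n v) -
          (wordCauchy lam (n + 1) w - wordCauchy lam n w)‖ +
        ‖wordCauchy lam n v - wordCauchy lam n w‖ := by
      refine le_of_eq_of_le ?_ (norm_add_le _ _)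
      congr 1
      ring
    set D := ‖point lam v - point lam w‖
    have hD : 0 ≤ D := norm_nonneg _
    set q : ℝ := (4 ^ n * side lam n ^ 2)⁻¹ with hq
    have hq0 : 0 < q := by positivity
    set ℓ := lipConst L with hℓ
    have hℓ' : ℓ * (1 - 4 * L ^ 2) = ((1 - 2 * L)⁻¹) ^ 2 := by
      have h1 : 0 < 1 - 4 * L ^ 2 := by nlinarith
      rw [hℓ, lipConst]
      field_simp
    have hl1 := h (n + 1) (by omega)
    have hlp : 0 < lam (n + 1) := by linarith [hl1.1]
    have hq1 : q ≤ 4 * L ^ 2 * (4 ^ (n + 1) * side lam (n + 1) ^ 2)⁻¹ := by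
      rw [side_succ, pow_succ, mul_pow, ← div_eq_mul_inv, le_div_iff₀ (by positivity), hq]
      have : lam (n + 1) ^ 2 ≤ L ^ 2 := pow_le_pow_left₀ hlp.le hl1.2 2
      have h4 := mul_le_mul_of_nonneg_left this (show (0 : ℝ) ≤ 4 ^ n * 4 by positivity)
      rw [pow_succ (4 : ℝ) n]
      field_simp
      linarith
    -- As $(1-2L)^{-2}=\ell(1-4L^2)$, the left side is $\ell\cdot4L^2(2-4L^2)=\ell(1-(1-4L^2)^2)$.
    have hfin : (ℓ + ((1 - 2 * L)⁻¹) ^ 2) * (4 * L ^ 2) ≤ ℓ := by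
      rw [← hℓ']
      have h1 : 0 < 1 - 4 * L ^ 2 := by nlinarith
      have h2 : 0 ≤ ℓ * (1 - 4 * L ^ 2) ^ 2 := by positivity
      nlinarith
    have hq1' : 0 < (4 ^ (n + 1) * side lam (n + 1) ^ 2)⁻¹ := by
      have := side_pos h (n + 1)
      positivity
    calc _ ≤ _ := htri
      _ ≤ ((1 - 2 * L) * side lam n)⁻¹ ^ 2 * D * (4 ^ n : ℝ)⁻¹ + ℓ * q * D := add_le_add hstep ih'
      _ = (ℓ + ((1 - 2 * L)⁻¹) ^ 2) * q * D := by
          rw [hq, mul_inv, mul_inv, mul_pow, inv_pow (side lam n)]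
          ring
      _ ≤ (ℓ + ((1 - 2 * L)⁻¹) ^ 2) * (4 * L ^ 2 * (4 ^ (n + 1) * side lam (n + 1) ^ 2)⁻¹) * D := by
          gcongr
      _ ≤ _ := by
          rw [← mul_assoc]
          gcongr

theorem norm_wordCauchy_sub_le (hL : L < 1 / 2) (h : ∀ n, 1 ≤ n → 1 / 4 ≤ lam n ∧ lam n ≤ L)
    {n : ℕ} {v w : ℕ → Bool × Bool} (hvw : v ∈ cyl n w) :
    ‖wordCauchy lam n v - wordCauchy lam n w‖ ≤ 2 * lipConst L * density lam n := by
  have hL0 : 0 ≤ L := by linarith [(h 1 le_rfl).1, (h 1 le_rfl).2]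
  have hl := lipConst_pos hL0 hL
  have hs := side_pos h n
  refine (norm_wordCauchy_sub_le_mul hL h hvw).trans ((mul_le_mul_of_nonneg_left
    (norm_point_sub_le hL h hvw) (by positivity)).trans (le_of_eq ?_))
  rw [density]
  field_simp

/-- An average differs from a value by at most the oscillation. -/
theorem norm_wordMart_sub_wordCauchy_le (hL : L < 1 / 2)
    (h : ∀ n, 1 ≤ n → 1 / 4 ≤ lam n ∧ lam n ≤ L) (n : ℕ) (w : ℕ → Bool × Bool) :
    ‖wordMart lam n w - wordCauchy lam n w‖ ≤ 2 * lipConst L * density lam n := by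
  have h4 : (4 : ℂ) ^ n ≠ 0 := pow_ne_zero _ (by norm_num)
  have h1 : wordMart lam n w - wordCauchy lam n w =
      4 ^ n * ∫ v in cyl n w, (wordCauchy lam n v - wordCauchy lam n w) ∂wordMeasure := by
    rw [integral_sub (integrable_wordCauchy hL h n).integrableOn
      (integrable_const _).integrableOn, setIntegral_const, wordMeasure_real_cyl, wordMart, mul_sub,
      Complex.real_smul]
    push_cast
    rw [← mul_assoc ((4 : ℂ) ^ n) ((4 : ℂ) ^ n)⁻¹, mul_inv_cancel₀ h4, one_mul]
  have h2 := norm_setIntegral_le_of_norm_le_const (μ := wordMeasure) (measure_lt_top _ (cyl n w))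
    fun v hv => norm_wordCauchy_sub_le hL h (n := n) (v := v) (w := w) hv
  rw [wordMeasure_real_cyl] at h2
  rw [h1, norm_mul, norm_pow, Complex.norm_ofNat]
  calc _ ≤ (4 : ℝ) ^ n * (2 * lipConst L * density lam n * ((4 : ℝ) ^ n)⁻¹) := by gcongr
    _ = _ := by field_simp

end Kernel


/-! ### Steering by a repeated letter -/

section Steering

variable {lam : ℕ → ℝ} {L : ℝ}

/-- A constant tail `b` puts the coordinate at the extreme end of its interval of generation `n`, so
every competitor lies on one side. -/
theorem bitSign_mul_tsum_sub_nonneg (hL : L < 1 / 2)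
    (h : ∀ n, 1 ≤ n → 1 / 4 ≤ lam n ∧ lam n ≤ L) {e d : ℕ → Bool} {n : ℕ} {b : Bool}
    (hed : ∀ k < n, d k = e k) (he : ∀ k, n ≤ k → e k = b) :
    0 ≤ bitSign b * (∑' k, offset lam k (e k) - ∑' k, offset lam k (d k)) := by
  rw [← (summable_offset hL h e).tsum_sub (summable_offset hL h d), ← tsum_mul_left]
  refine tsum_nonneg fun k => ?_
  rcases lt_or_ge k n with hk | hk
  · rw [hed k hk, sub_self, mul_zero]
  · rw [he k hk]
    have h1 := offset_bounds hL h k (d k)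
    cases b
    · rw [show offset lam k false = 0 by simp [offset], bitSign, if_neg Bool.false_ne_true]
      linarith [h1.1]
    · rw [show offset lam k true = side lam k - side lam (k + 1) by simp [offset], bitSign,
        if_pos rfl]
      linarith [h1.2]

theorem gap_mul_side_le_bitSign_mul (hL : L < 1 / 2)
    (h : ∀ n, 1 ≤ n → 1 / 4 ≤ lam n ∧ lam n ≤ L) {e d : ℕ → Bool} {n : ℕ}
    (hed : ∀ k < n, d k = e k) (hd : d n = !e n) :
    (1 - 2 * L) * side lam n ≤
      bitSign (e n) * (∑' k, offset lam k (e k) - ∑' k, offset lam k (d k)) := by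
  cases he : e n
  · have := gap_mul_side_le_tsum_sub hL h (n := n) hed (by simp [hd, he]) he
    simpa [bitSign] using this
  · have := gap_mul_side_le_tsum_sub hL h (n := n) (fun k hk => (hed k hk).symm) he
      (by simp [hd, he])
    simpa [bitSign] using this

theorem one_div_re (x : ℂ) : (1 / x).re = x.re / ‖x‖ ^ 2 := by
  rw [one_div, Complex.inv_re, Complex.sq_norm]

theorem one_div_im (x : ℂ) : (1 / x).im = -(x.im / ‖x‖ ^ 2) := by
  rw [one_div, Complex.inv_im, Complex.sq_norm, neg_div]

/-- Integrating a nonnegative function that is bounded below on one subsquare. -/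
theorem density_le_integral (hL : L < 1 / 2) (h : ∀ n, 1 ≤ n → 1 / 4 ≤ lam n ∧ lam n ≤ L)
    (n : ℕ) (w : ℕ → Bool × Bool) {f : (ℕ → Bool × Bool) → ℝ} (hf : Integrable f wordMeasure)
    (h0 : ∀ u, 0 ≤ f u) (h1 : ∀ u ∈ cyl (n + 1) w, (1 - 2 * L) / (4 * side lam n) ≤ f u) :
    (1 - 2 * L) / 16 * density lam n ≤ ∫ u, f u ∂wordMeasure := by
  have hs := side_pos h n
  have hc : 0 ≤ (1 - 2 * L) / (4 * side lam n) := by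
    have : 0 < 1 - 2 * L := by linarith
    positivity
  calc (1 - 2 * L) / 16 * density lam n
      = wordMeasure.real (cyl (n + 1) w) * ((1 - 2 * L) / (4 * side lam n)) := by
        rw [wordMeasure_real_cyl, density, pow_succ]
        field_simp
        norm_num
    _ = ∫ _ in cyl (n + 1) w, (1 - 2 * L) / (4 * side lam n) ∂wordMeasure := by
        rw [setIntegral_const, smul_eq_mul]
    _ ≤ ∫ u in cyl (n + 1) w, f u ∂wordMeasure :=
        setIntegral_mono_on (integrable_const _).integrableOn hf.integrableOn
          (measurableSet_cyl _ _) h1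
    _ ≤ ∫ u, f u ∂wordMeasure := setIntegral_le_integral hf (Eventually.of_forall h0)

theorem div_le_of_gap {x s D g : ℝ} (hg : 0 ≤ g) (hs : 0 < s) (hD : 0 < D) (hD2 : D ≤ 2 * s)
    (hx : g * s ≤ x) : g / (4 * s) ≤ x / D ^ 2 := by
  have hx0 : 0 ≤ x := (mul_nonneg hg hs.le).trans hx
  have h1 : D ^ 2 ≤ (2 * s) ^ 2 := pow_le_pow_left₀ hD.le hD2 2
  calc g / (4 * s) = g * s / (2 * s) ^ 2 := by
        field_simp
        norm_num
    _ ≤ x / D ^ 2 := by gcongr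

/-- Steering in the direction given by one of the coordinates `π` of a letter. -/
theorem density_le_integral_kernelStep (hL : L < 1 / 2)
    (h : ∀ n, 1 ≤ n → 1 / 4 ≤ lam n ∧ lam n ≤ L) {n : ℕ} {w : ℕ → Bool × Bool} {b : Bool × Bool}
    (hw : ∀ k, n ≤ k → w k = b) (π : Bool × Bool → Bool) (hπ : π (!b.1, !b.2) = !π b) (ρ : ℂ → ℝ)
    (hρ : ∀ v u, ρ (1 / (point lam v - point lam u)) =
      bitSign (π b) * (∑' k, offset lam k (π (v k)) - ∑' k, offset lam k (π (u k))) /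
        ‖point lam v - point lam u‖ ^ 2) (hρ0 : ρ 0 = 0)
    (hint : Integrable (fun u => ρ (kernelStep lam n w u)) wordMeasure) :
    (1 - 2 * L) / 16 * density lam n ≤ ∫ u, ρ (kernelStep lam n w u) ∂wordMeasure := by
  -- The diagonally opposite subsquare supplies the lower bound: it is separated in both
  -- coordinates, so it serves either choice of `π`.
  refine density_le_integral hL h n (Function.update w n (!b.1, !b.2)) hint (fun u => ?_)
    fun u hu => ?_
  · by_cases h1 : u ∈ cyl n w
    · by_cases h2 : u ∈ cyl (n + 1) w
      · rw [kernelStep_of_mem_succ h2, hρ0]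
      · rw [kernelStep_of_mem h1 h2, hρ]
        refine div_nonneg (bitSign_mul_tsum_sub_nonneg hL h (n := n) (e := fun k => π (w k))
          (d := fun k => π (u k)) (fun k hk => ?_) fun k hk => ?_) (by positivity)
        · rw [h1 k hk]
        · rw [hw k hk]
    · rw [kernelStep_of_notMem h1, hρ0]
  · have hun : u n = (!b.1, !b.2) := by rw [hu n (by omega), Function.update_self]
    have h1 : u ∈ cyl n w := fun k hk => by rw [hu k (by omega), Function.update_of_ne hk.ne]
    have h2 : u ∉ cyl (n + 1) w := fun H => by
      have := H n (by omega)
      rw [hun, hw n le_rfl] at this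
      have := congrArg Prod.fst this
      simp at this
    have hs := side_pos h n
    have hg : 0 < 1 - 2 * L := by linarith
    rw [kernelStep_of_mem h1 h2, hρ]
    refine div_le_of_gap hg.le hs ?_ (norm_point_sub_le hL h (mem_cyl_comm.1 h1)) ?_
    · rw [norm_pos_iff, sub_ne_zero]
      intro H
      rw [point_injective hL h H] at h2
      exact h2 (mem_cyl_self _ _)
    · have := gap_mul_side_le_bitSign_mul hL h (n := n) (e := fun k => π (w k))
        (d := fun k => π (u k)) (fun k hk => by rw [h1 k hk]) (by rw [hun, hw n le_rfl, hπ])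
      simp only [hw n le_rfl] at this
      exact this

theorem density_le_wordCauchy_sub_re (hL : L < 1 / 2)
    (h : ∀ n, 1 ≤ n → 1 / 4 ≤ lam n ∧ lam n ≤ L) {n : ℕ} {w : ℕ → Bool × Bool} {b : Bool × Bool}
    (hw : ∀ k, n ≤ k → w k = b) :
    (1 - 2 * L) / 16 * density lam n ≤
      bitSign b.1 * (wordCauchy lam (n + 1) w - wordCauchy lam n w).re := by
  have hi : Integrable (kernelStep lam n w) wordMeasure :=
    (integrable_truncKernel hL h (n + 1) w).sub (integrable_truncKernel hL h n w)
  have hre := Complex.reCLM.integral_comp_comm hi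
  simp only [Complex.reCLM_apply] at hre
  rw [← integral_kernelStep hL h, ← hre, ← integral_const_mul]
  refine density_le_integral_kernelStep hL h hw Prod.fst rfl (fun x => bitSign b.1 * x.re)
    (fun v u => ?_) (by simp) (hi.re.const_mul _)
  rw [one_div_re, mul_div_assoc]
  rfl

theorem density_le_wordCauchy_sub_im (hL : L < 1 / 2)
    (h : ∀ n, 1 ≤ n → 1 / 4 ≤ lam n ∧ lam n ≤ L) {n : ℕ} {w : ℕ → Bool × Bool} {b : Bool × Bool}
    (hw : ∀ k, n ≤ k → w k = b) :
    (1 - 2 * L) / 16 * density lam n ≤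
      -bitSign b.2 * (wordCauchy lam (n + 1) w - wordCauchy lam n w).im := by
  have hi : Integrable (kernelStep lam n w) wordMeasure :=
    (integrable_truncKernel hL h (n + 1) w).sub (integrable_truncKernel hL h n w)
  have him := Complex.imCLM.integral_comp_comm hi
  simp only [Complex.imCLM_apply] at him
  rw [← integral_kernelStep hL h, ← him, ← integral_const_mul]
  refine density_le_integral_kernelStep hL h hw Prod.snd rfl (fun x => -bitSign b.2 * x.im)
    (fun v u => ?_) (by simp) (hi.im.const_mul _)
  rw [one_div_im, mul_div_assoc, neg_mul_neg]
  rfl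

theorem wordMart_congr (lam : ℕ → ℝ) {n : ℕ} {v w : ℕ → Bool × Bool} (hvw : ∀ k < n, v k = w k) :
    wordMart lam n v = wordMart lam n w := by
  rw [wordMart, wordMart, cyl_eq hvw]

theorem sum_le_of_forall_step {x a : ℕ → ℝ} {c s : ℝ} {n : ℕ}
    (hstep : ∀ k, n ≤ k → c * a k ≤ s * (x (k + 1) - x k)) (N : ℕ) :
    c * ∑ j ∈ Finset.range N, a (n + j) ≤ s * (x (n + N) - x n) := by
  induction N with
  | zero => simp
  | succ N ih =>
    rw [Finset.sum_range_succ, mul_add, ← add_assoc]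
    linarith [hstep (n + N) (by omega)]

/-- Sign and size of increments are known for $T_n$, the martingale property for $S_n$. Passing from
one to the other costs only the two end errors, however large `N` is. -/
theorem steer_of_approx {x y a : ℕ → ℝ} {c s D : ℝ} (hs : |s| = 1) (ha : Antitone a)
    (hD : 0 ≤ D) (hxy : ∀ k, |y k - x k| ≤ D * a k) {n : ℕ}
    (hstep : ∀ k, n ≤ k → c * a k ≤ s * (x (k + 1) - x k)) (N : ℕ) :
    c * ∑ j ∈ Finset.range N, a (n + j) - 2 * D * a n ≤ s * (y (n + N) - y n) := by
  have h1 := sum_le_of_forall_step hstep N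
  have h2 : ∀ k, |s * (y k - x k)| ≤ D * a k := fun k => by rw [abs_mul, hs, one_mul]; exact hxy k
  have h3 := (abs_le.1 (h2 (n + N))).1
  have h4 := (abs_le.1 (h2 n)).2
  have h5 := mul_le_mul_of_nonneg_left (ha (show n ≤ n + N by omega)) hD
  linarith

theorem steerableMartingale_wordMart (hL : L < 1 / 2)
    (h : ∀ n, 1 ≤ n → 1 / 4 ≤ lam n ∧ lam n ≤ L) :
    SteerableMartingale (wordMart lam) (density lam) (4 * lipConst L + (1 - 2 * L)⁻¹)
      ((1 - 2 * L) / 16) := by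
  have hL0 : 0 ≤ L := by linarith [(h 1 le_rfl).1, (h 1 le_rfl).2]
  have hl := lipConst_pos hL0 hL
  have hg : 0 < 1 - 2 * L := by linarith
  have hg' : 0 < (1 - 2 * L)⁻¹ := by positivity
  -- The constant has to cover both a martingale step, $(1-2L)^{-1}$ plus $2\ell$ at each end, and
  -- the steering error $4\ell$.
  have hC : ∀ n, 2 * (2 * lipConst L) * density lam n ≤
      (4 * lipConst L + (1 - 2 * L)⁻¹) * density lam n := fun n =>
    mul_le_mul_of_nonneg_right (by linarith) (density_pos h n).le
  refine ⟨fun n v w hvw => wordMart_congr lam hvw, fun n w => ?_, sum_wordMart_update hL h,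
    fun n N w b hw => ?_, fun n N w b hw => ?_, density_antitone h,
    fun n => (density_pos h n).le, by positivity, by positivity⟩
  · have h1 := norm_wordMart_sub_wordCauchy_le hL h (n + 1) w
    have h2 := norm_wordMart_sub_wordCauchy_le hL h n w
    have h3 := norm_wordCauchy_succ_sub_le hL h n w
    have h4 := mul_le_mul_of_nonneg_left (density_antitone h (show n ≤ n + 1 by omega)) hl.le
    rw [norm_sub_rev] at h2
    have : wordMart lam (n + 1) w - wordMart lam n w =
        (wordMart lam (n + 1) w - wordCauchy lam (n + 1) w) +
        (wordCauchy lam (n + 1) w - wordCauchy lam n w) +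
        (wordCauchy lam n w - wordMart lam n w) := by ring
    rw [this]
    refine (norm_add₃_le).trans ?_
    linarith
  · have := steer_of_approx (x := fun k => (wordCauchy lam k w).re)
      (y := fun k => (wordMart lam k w).re) (a := density lam) (c := (1 - 2 * L) / 16)
      (s := bitSign b.1) (D := 2 * lipConst L) (SteerableMartingale.abs_bitSign _)
      (density_antitone h) (by positivity)
      (fun k => (Complex.abs_re_le_norm (wordMart lam k w - wordCauchy lam k w)).trans
        (norm_wordMart_sub_wordCauchy_le hL h k w)) (n := n)
      (fun k hk => density_le_wordCauchy_sub_re hL h fun j hj => hw j (hk.trans hj)) N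
    rw [Complex.sub_re]
    linarith [hC n]
  · have := steer_of_approx (x := fun k => (wordCauchy lam k w).im)
      (y := fun k => (wordMart lam k w).im) (a := density lam) (c := (1 - 2 * L) / 16)
      (s := -bitSign b.2) (D := 2 * lipConst L)
      ((abs_neg _).trans (SteerableMartingale.abs_bitSign _))
      (density_antitone h) (by positivity)
      (fun k => (Complex.abs_im_le_norm (wordMart lam k w - wordCauchy lam k w)).trans
        (norm_wordMart_sub_wordCauchy_le hL h k w)) (n := n)
      (fun k hk => density_le_wordCauchy_sub_im hL h fun j hj => hw j (hk.trans hj)) N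
    rw [Complex.sub_im]
    linarith [hC n]

end Steering

/-! ### Conclusion -/

section Conclusion

variable {lam : ℕ → ℝ} {L : ℝ}

theorem one_le_dimH_tendsto (hL : L < 1 / 2) (h : ∀ n, 1 ≤ n → 1 / 4 ≤ lam n ∧ lam n ≤ L)
    (ha : Tendsto (density lam) atTop (𝓝 0)) (hs : ¬ Summable (density lam)) (z : ℂ) :
    1 ≤ dimH {x ∈ cantorSet lam | Tendsto (fun n => mart lam n x) atTop (𝓝 z)} := by
  have key : ∀ r : ℝ, 0 < r → r < 1 → ENNReal.ofReal r ≤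
      dimH {x ∈ cantorSet lam | Tendsto (fun n => mart lam n x) atTop (𝓝 z)} := by
    intro r hr0 hr1
    obtain ⟨M, m, φ, hm, hM, hφ, hlim⟩ :=
      (steerableMartingale_wordMart hL h).exists_tree (density_pos h) ha hs z hr1
    refine (le_dimH_range_point hL h hr0 hm hM hφ).trans (dimH_mono ?_)
    rintro _ ⟨g, rfl⟩
    exact ⟨point_mem_cantorSet hL h _, by simpa only [mart_point hL h] using hlim g⟩
  have hlim : Tendsto (fun r : ℝ => ENNReal.ofReal r) (𝓝[<] 1) (𝓝 1) := by
    have := ENNReal.tendsto_ofReal (tendsto_id (α := ℝ) (x := 𝓝 1))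
    rw [ENNReal.ofReal_one] at this
    exact this.mono_left nhdsWithin_le_nhds
  refine le_of_tendsto hlim ?_
  filter_upwards [Ioo_mem_nhdsLT (zero_lt_one' ℝ)] with r hr
  exact key r hr.1 hr.2

theorem exists_tendsto_mart_point (hL : L < 1 / 2)
    (h : ∀ n, 1 ≤ n → 1 / 4 ≤ lam n ∧ lam n ≤ L) (hs : Summable (density lam))
    (w : ℕ → Bool × Bool) : ∃ z : ℂ, Tendsto (fun n => mart lam n (point lam w)) atTop (𝓝 z) := by
  simp only [mart_point hL h]
  refine cauchySeq_tendsto_of_complete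
    (cauchySeq_of_dist_le_of_summable _ (fun n => ?_) (hs.mul_left (4 * lipConst L + (1 - 2 * L)⁻¹)))
  rw [dist_comm, dist_eq_norm]
  exact (steerableMartingale_wordMart hL h).norm_step_le n w

/-- A dichotomy: for summable densities every point of $K$ qualifies; otherwise the points where the
limit is `0` suffice. -/
theorem one_le_dimH_exists_tendsto (hL : L < 1 / 2)
    (h : ∀ n, 1 ≤ n → 1 / 4 ≤ lam n ∧ lam n ≤ L) (ha : Tendsto (density lam) atTop (𝓝 0)) :
    1 ≤ dimH {x ∈ cantorSet lam | ∃ z : ℂ, Tendsto (fun n => mart lam n x) atTop (𝓝 z)} := by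
  by_cases hs : Summable (density lam)
  · refine (one_le_dimH_range_point hL h).trans (dimH_mono ?_)
    rintro _ ⟨w, rfl⟩
    exact ⟨point_mem_cantorSet hL h w, exists_tendsto_mart_point hL h hs w⟩
  · exact (one_le_dimH_tendsto hL h ha hs 0).trans
      (dimH_mono fun x hx => ⟨hx.1, 0, hx.2⟩)

theorem not_summable_of_not_summable_sq {a : ℕ → ℝ} (ha : Tendsto a atTop (𝓝 0))
    (h0 : ∀ n, 0 ≤ a n) (hs : ¬ Summable fun n => a n ^ 2) : ¬ Summable a := by
  intro H
  refine hs (Summable.of_norm_bounded_eventually_nat H ?_)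
  filter_upwards [ha.eventually (gt_mem_nhds one_pos)] with n hn
  rw [Real.norm_of_nonneg (sq_nonneg _)]
  nlinarith [h0 n]

end Conclusion

end CantorCauchy

end

theorem theorem2p1 (lam : ℕ → ℝ) (L : ℝ) (hL : L < 1 / 2)
    (hlam : ∀ n, 1 ≤ n → 1 / 4 ≤ lam n ∧ lam n ≤ L)
    (ha : Tendsto (CantorCauchy.density lam) atTop (𝓝 0)) :
    1 ≤ dimH {x ∈ CantorCauchy.cantorSet lam |
        ∃ z : ℂ, Tendsto (fun n => CantorCauchy.mart lam n x) atTop (𝓝 z)} ∧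
    (dimH (CantorCauchy.cantorSet lam) = 1 →
      dimH {x ∈ CantorCauchy.cantorSet lam |
        ∃ z : ℂ, Tendsto (fun n => CantorCauchy.mart lam n x) atTop (𝓝 z)} = 1) ∧
    (¬ Summable (fun n => CantorCauchy.density lam n ^ 2) →
      dimH {x ∈ CantorCauchy.cantorSet lam |
        ∃ z : ℂ, Tendsto (fun n => CantorCauchy.mart lam n x) atTop (𝓝 z)} = 1 ∧
      ∀ z₀ : ℂ, dimH {x ∈ CantorCauchy.cantorSet lam |
        Tendsto (fun n => CantorCauchy.mart lam n x) atTop (𝓝 z₀)} = 1) := by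
  have h1 := CantorCauchy.one_le_dimH_exists_tendsto hL hlam ha
  refine ⟨h1, fun hK => le_antisymm ((dimH_mono (Set.sep_subset _ _)).trans hK.le) h1,
    fun hs => ?_⟩
  have hK := CantorCauchy.dimH_cantorSet_le_one hL hlam hs
  have hs' := CantorCauchy.not_summable_of_not_summable_sq ha
    (fun n => (CantorCauchy.density_pos hlam n).le) hs
  exact ⟨le_antisymm ((dimH_mono (Set.sep_subset _ _)).trans hK) h1, fun z₀ =>
    le_antisymm ((dimH_mono (Set.sep_subset _ _)).trans hK)
      (CantorCauchy.one_le_dimH_tendsto hL hlam ha hs' z₀)⟩
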